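/- Let $n\ge 3$, $m\ge 0$, $c>0$, and let $f\in C_c^\infty(\mathbb R^{1+n};S^m)$ be a smooth compactly supported field of complex symmetric $m$-tensors on $\mathbb R^{1+n}$, with components $f_{i_1\dots i_m}$, $0\le i_1,\dots,i_m\le n$. For $(t,x)\in\mathbb R^{1+n}$ and $\omega\in\mathbb S^{n-1}$ put $\tilde\omega=(c,\omega)\in\mathbb R^{1+n}$ and define the momentum light ray transform of order $m$ $$\tilde L^{m,m}f((t,x),\omega)=\sum_{i_1,\dots,i_m=0}^n\tilde\omega_{i_1}\cdots\tilde\omega_{i_m}\int_{\mathbb R}s^m f_{i_1\dots i_m}((t,x)+s\tilde\omega)\,ds .$$ Let $g_{1/c}=\operatorname{diag}(-c^{-2},1,\dots,1)$ and, for an $(m-2)$-tensor $h$ with $m\ge 2$, let $i_{g_{1/c}}h$ be the symmetrized product $$(i_{g_{1/c}}h)_{i_1\dots i_m}=\frac1{m!}\sum_{\pi\in\Pi_m}h_{i_{\pi(1)}\dots i_{\pi(m-2)}}(g_{1/c})_{i_{\pi(m-1)}i_{\pi(m)}},$$ where $\Pi_m$ is the group of permutations of $\{1,\dots,m\}$.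 Fix $\omega_0\in\mathbb S^{n-1}$ and $\delta>0$, and let $B_n(\omega_0,\delta)=\{\omega\in\mathbb S^{n-1}:|\omega-\omega_0|<\delta\}$. Then $\tilde L^{m,m}f((t,x),\omega)=0$ for all $(t,x)\in\mathbb R^{1+n}$ and all $\omega\in B_n(\omega_0,\delta)$ if and only if - $f=0$, when $m\in\{0,1\}$; - $f=i_{g_{1/c}}h$ for some $h\in C_c^\infty(\mathbb R^{1+n};S^{m-2})$, when $m\ge 2$. -/

import Mathlib

noncomputable section

namespace MLRT

/-- The spacetime `ℝ^{1+n}`. Coordinate `0` is the time `t`, coordinates `1, …, n` are `x`. -/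
abbrev Spacetime (n : ℕ) : Type := EuclideanSpace ℝ (Fin (n + 1))

/-- Complex tensors of rank `m` on `ℝ^{1+n}`, given by their components
`T i = T_{i_1 … i_m}` in the standard basis `e_0, …, e_n`. -/
abbrev Tensor (n m : ℕ) : Type := (Fin m → Fin (n + 1)) → ℂ

/-- The complex vector space `S^m` of symmetric tensors of rank `m` on `ℝ^{1+n}`. -/
def symTensor (n m : ℕ) : Submodule ℂ (Tensor n m) where
  carrier := {T | ∀ (π : Equiv.Perm (Fin m)) (i : Fin m → Fin (n + 1)), T (i ∘ π) = T i}
  add_mem' := fun hS hT π i => by simp [hS π i, hT π i]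
  zero_mem' := fun _ _ => rfl
  smul_mem' := fun a T hT π i => by simp [hT π i]

/-- `f ∈ C_c^∞(ℝ^{1+n}; S^m)`: a smooth, compactly supported symmetric `m`-tensor field. -/
structure IsTestField {n m : ℕ} (f : Spacetime n → Tensor n m) : Prop where
  symm : ∀ p, f p ∈ symTensor n m
  smooth : ContDiff ℝ ((⊤ : ℕ∞) : WithTop ℕ∞) f
  compactSupport : HasCompactSupport f

/-- The direction `(c, ω) ∈ ℝ^{1+n}`. -/
def direction {n : ℕ} (c : ℝ) (ω : EuclideanSpace ℝ (Fin n)) : Spacetime n :=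
  WithLp.toLp 2 (Fin.cons c (fun j => ω j) : Fin (n + 1) → ℝ)

/-- The `k`-th momentum light ray transform `L^{m,k} f (p, ω)` with speed parameter `c`, where
`p = (t, x)`; its values at unit vectors `ω` are those of the restricted transform. -/
def momentumLightRay {n m : ℕ} (c : ℝ) (k : ℕ) (f : Spacetime n → Tensor n m)
    (p : Spacetime n) (ω : EuclideanSpace ℝ (Fin n)) : ℂ :=
  ∑ i : Fin m → Fin (n + 1), ((∏ j, direction c ω (i j) : ℝ) : ℂ) *
    ∫ s : ℝ, ((s ^ k : ℝ) : ℂ) * f (p + s • direction c ω) i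

/-- The Minkowski metric `g_c = diag(-c², 1, …, 1)`, as a tensor of rank `2`. -/
def minkowski (n : ℕ) (c : ℝ) : Tensor n 2 := fun i =>
  if i 0 = i 1 then (if i 0 = 0 then -((c : ℂ) ^ 2) else 1) else 0

/-- The symmetric product `i_v u = v ⊙ u ∈ S^m` of a `2`-tensor `v` and an `(m-2)`-tensor `u`:
`(i_v u)_{i_1 … i_m} = (1/m!) ∑_π u_{i_{π(1)} … i_{π(m-2)}} v_{i_{π(m-1)} i_{π(m)}}`. -/
def symMul {n m : ℕ} (hm : 2 ≤ m) (v : Tensor n 2) (u : Tensor n (m - 2)) : Tensor n m :=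
  fun i => ((Nat.factorial m : ℕ) : ℂ)⁻¹ * ∑ π : Equiv.Perm (Fin m),
    u (fun j : Fin (m - 2) => i (π ⟨j, by omega⟩)) *
      v ![i (π ⟨m - 2, by omega⟩), i (π ⟨m - 1, by omega⟩)]

/-- The relatively open cap `B_n(ω₀, δ)` of the unit sphere of `ℝ^n`. -/
def cap {n : ℕ} (ω₀ : EuclideanSpace ℝ (Fin n)) (δ : ℝ) : Set (EuclideanSpace ℝ (Fin n)) :=
  {ω | ω ∈ Metric.sphere (0 : EuclideanSpace ℝ (Fin n)) 1 ∧ ‖ω - ω₀‖ < δ}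

end MLRT

end

/-! For fixed x put F_x(y) = ∑ f_{i_1…i_m}(y) x_{i_1}⋯x_{i_m}. If the order-m moments of F_v vanish
on all lines of direction v = (c, ω), moving the base point along v kills the lower moments too
(`moment_eq_zero_of_le`), so the Fourier transform of F_v vanishes to order m + 1 on v^⊥
(`norm_fourierIntegral_le`).

Since n ≥ 3, an open set of covectors ξ annihilates two distinct cap directions v₁, v₂
(`exists_eventually_orthogonal`). Fix such a ξ. A null u that is Lorentz orthogonal to neither v₁
nor v₂ lies on a conic a²αv₁ + ab q + b²βv₂ of null vectors. Along it the form x ↦ f̂(ξ)(x,…,x) has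
degree at most 2m in the parameter. Near either end the conic stays over the cap and its pairing
with ξ is O(t), so the form vanishes there to order m + 1, hence identically
(`contract_eq_zero_of_isBigO`). Thus f̂(ξ) vanishes on the whole cone for an open set of ξ, and
analyticity in ξ gives the same for every f(y) (`eq_zero_of_fourierIntegral_eventually_zero`).

The rest is algebra: a polynomial vanishing on the real light cone is a multiple of the Minkowski
form (`minkowski_dvd_of_vanishes_on_cone`), and a fixed linear right inverse picks the quotient
smoothly in y (`exists_testField_symMul_eq`). Conversely, the form of g_{1/c} vanishes at every (c,
ω). -/

namespace MLRT

open MeasureTheory Filter Topology FourierTransform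

/-! ### Line moments and Fourier transforms of scalar functions -/

section Scalar

variable {E : Type*} [NormedAddCommGroup E] [InnerProductSpace ℝ E]

theorem hasCompactSupport_line {F : E → ℂ} (hF : HasCompactSupport F) {v : E} (hv : v ≠ 0)
    (p : E) : HasCompactSupport fun s : ℝ => F (p + s • v) := by
  have hv2 : inner ℝ v v ≠ 0 := by simpa using hv
  refine HasCompactSupport.intro
    -- This quotient recovers s from the point y = p + s v.
    (K := (fun y => inner ℝ v (y - p) / inner ℝ v v) '' tsupport F)
    (IsCompact.image hF (by fun_prop)) fun s hs => ?_
  by_contra hne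
  refine hs ⟨p + s • v, subset_tsupport _ hne, ?_⟩
  simp only [add_sub_cancel_left, inner_smul_right]
  field_simp

theorem integrable_pow_mul_line {F : E → ℂ} (hF : Continuous F) (hc : HasCompactSupport F)
    {v : E} (hv : v ≠ 0) (p : E) (k : ℕ) :
    Integrable fun s : ℝ => ((s ^ k : ℝ) : ℂ) * F (p + s • v) :=
  Continuous.integrable_of_hasCompactSupport (by fun_prop)
    ((hasCompactSupport_line hc hv p).mul_left)

/-- If the moment of order `m` vanishes along all lines of direction `v`, then so do all lower
moments: translating the base point along `v` gives a polynomial in the translation parameter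
whose coefficients are the lower moments. -/
theorem moment_eq_zero_of_le {F : E → ℂ} (hF : Continuous F) (hc : HasCompactSupport F)
    {v : E} (hv : v ≠ 0) {m : ℕ}
    (h : ∀ p, ∫ s : ℝ, ((s ^ m : ℝ) : ℂ) * F (p + s • v) = 0) {k : ℕ} (hk : k ≤ m) (p : E) :
    ∫ s : ℝ, ((s ^ k : ℝ) : ℂ) * F (p + s • v) = 0 := by
  set M : ℕ → ℂ := fun j => ∫ s : ℝ, ((s ^ j : ℝ) : ℂ) * F (p + s • v) with hM
  have key : ∀ τ : ℝ, ∑ j ∈ Finset.range (m + 1), M j * (m.choose j : ℂ) * (τ : ℂ) ^ (m - j) = 0 := by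
    intro τ
    have h1 := h (p + (-τ) • v)
    have h2 := integral_add_right_eq_self (μ := volume)
      (fun s : ℝ => (((s + τ) ^ m : ℝ) : ℂ) * F (p + s • v)) (-τ)
    have h3 : ∫ s : ℝ, (((s + τ) ^ m : ℝ) : ℂ) * F (p + s • v) = 0 := by
      rw [← h2, ← h1]
      congr 1
      ext s
      rw [neg_add_cancel_right, add_assoc, ← add_smul, add_comm (-τ) s]
    rw [← h3]
    have h4 : ∀ s : ℝ, (((s + τ) ^ m : ℝ) : ℂ) * F (p + s • v) =
        ∑ j ∈ Finset.range (m + 1),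
          ((s ^ j : ℝ) : ℂ) * F (p + s • v) * ((m.choose j : ℂ) * (τ : ℂ) ^ (m - j)) := by
      intro s
      rw [add_pow, Complex.ofReal_sum, Finset.sum_mul]
      refine Finset.sum_congr rfl fun j _ => ?_
      push_cast
      ring
    simp_rw [h4]
    rw [integral_finsetSum _ fun j _ => (integrable_pow_mul_line hF hc hv p j).mul_const _]
    refine Finset.sum_congr rfl fun j _ => ?_
    rw [integral_mul_const, mul_assoc]
  set Q : Polynomial ℂ := ∑ j ∈ Finset.range (m + 1),
    Polynomial.C (M j * (m.choose j : ℂ)) * Polynomial.X ^ (m - j) with hQ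
  -- By `key`, every real τ is a root.
  have hQ0 : Q = 0 := by
    refine Polynomial.eq_zero_of_infinite_isRoot Q ?_
    refine (Set.infinite_range_of_injective Complex.ofReal_injective).mono ?_
    rintro _ ⟨τ, rfl⟩
    simpa [Polynomial.IsRoot, hQ, Polynomial.eval_finsetSum] using key τ
  have hcoef : Q.coeff (m - k) = M k * (m.choose k : ℂ) := by
    rw [hQ, Polynomial.finsetSum_coeff, Finset.sum_eq_single k]
    · rw [Polynomial.coeff_C_mul_X_pow, if_pos rfl]
    · intro j hj hjk
      have : j ≤ m := Nat.lt_succ_iff.mp (Finset.mem_range.mp hj)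
      rw [Polynomial.coeff_C_mul_X_pow, if_neg (by omega)]
    · intro hk'
      exact absurd (Finset.mem_range.mpr (by omega)) hk'
  rw [hQ0, Polynomial.coeff_zero] at hcoef
  have hch : (m.choose k : ℂ) ≠ 0 := by exact_mod_cast (Nat.choose_pos hk).ne'
  exact (mul_eq_zero.mp hcoef.symm).resolve_right hch

variable [FiniteDimensional ℝ E] [MeasurableSpace E] [BorelSpace E]

/-- Fubini without choosing a complement of v: base points p are weighted by a bump r in the
coordinate l along v, and the double integral of r(l p) G(p + s v) equals (∫ r)(∫ G) with ∫ r ≠ 0.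
-/
theorem integral_eq_zero_of_line_integrals {G : E → ℂ} (hG : Continuous G)
    (hc : HasCompactSupport G) {v : E} (hv : v ≠ 0) (h : ∀ p, ∫ s : ℝ, G (p + s • v) = 0) :
    ∫ y, G y = 0 := by
  have hv2 : inner ℝ v v ≠ 0 := by simpa using hv
  let ρ : ContDiffBump (0 : ℝ) := default
  let r : ℝ → ℂ := fun a => (ρ a : ℝ)
  have hrc : Continuous r := Complex.continuous_ofReal.comp ρ.continuous
  have hrs : HasCompactSupport r := ρ.hasCompactSupport.comp_left (g := Complex.ofReal) rfl
  have hr : ∫ a, r a ≠ 0 := by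
    rw [integral_complex_ofReal]
    exact_mod_cast (ρ.integral_pos (μ := volume)).ne'
  let l : E → ℝ := fun y => inner ℝ v y / inner ℝ v v
  have hlc : Continuous l := by fun_prop
  have hl : ∀ p (s : ℝ), l (p + s • v) = l p + s := by
    intro p s
    simp only [l, inner_add_right, inner_smul_right]
    field_simp
  have swap1 : ∫ p, ∫ s : ℝ, r (l p) * G (p + s • v) = ∫ s : ℝ, ∫ p, r (l p) * G (p + s • v) := by
    refine integral_integral_swap_of_hasCompactSupport
      (f := fun p (s : ℝ) => r (l p) * G (p + s • v)) (by fun_prop) ?_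
    refine HasCompactSupport.intro
      (K := (fun q : ℝ × E => (q.2 - (l q.2 - q.1) • v, l q.2 - q.1)) ''
        (tsupport r ×ˢ tsupport G)) ((IsCompact.prod hrs hc).image (by fun_prop)) ?_
    rintro ⟨p, s⟩ hps
    by_contra hne
    simp only [Function.uncurry] at hne
    refine hps ⟨(l p, p + s • v), ⟨subset_tsupport _ (left_ne_zero_of_mul hne),
      subset_tsupport _ (right_ne_zero_of_mul hne)⟩, ?_⟩
    simp [hl]
  have swap2 : ∫ s : ℝ, ∫ y, r (l y - s) * G y = ∫ y, ∫ s : ℝ, r (l y - s) * G y := by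
    refine integral_integral_swap_of_hasCompactSupport
      (f := fun (s : ℝ) y => r (l y - s) * G y) (by fun_prop) ?_
    refine HasCompactSupport.intro
      (K := (fun q : ℝ × E => (l q.2 - q.1, q.2)) ''
        (tsupport r ×ˢ tsupport G)) ((IsCompact.prod hrs hc).image (by fun_prop)) ?_
    rintro ⟨s, y⟩ hps
    by_contra hne
    simp only [Function.uncurry] at hne
    refine hps ⟨(l y - s, y), ⟨subset_tsupport _ (left_ne_zero_of_mul hne),
      subset_tsupport _ (right_ne_zero_of_mul hne)⟩, ?_⟩
    simp
  have h0 : ∫ p, ∫ s : ℝ, r (l p) * G (p + s • v) = 0 := by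
    simp_rw [integral_const_mul, h, mul_zero, integral_zero]
  have hmid : ∀ s : ℝ, ∫ p, r (l p) * G (p + s • v) = ∫ y, r (l y - s) * G y := by
    intro s
    rw [← integral_add_right_eq_self (fun y => r (l y - s) * G y) (s • v)]
    simp [hl]
  have hfin : ∀ y, ∫ s : ℝ, r (l y - s) * G y = (∫ a, r a) * G y := by
    intro y
    rw [integral_mul_const, integral_sub_left_eq_self r volume (l y)]
  rw [swap1] at h0
  simp_rw [hmid] at h0
  rw [swap2] at h0
  simp_rw [hfin, integral_const_mul] at h0
  exact (mul_eq_zero.mp h0).resolve_left hr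

/-- The Fourier transform with kernel `exp (i ⟨ξ, y⟩)`. -/
noncomputable def fourierIntegral (F : E → ℂ) (ξ : E) : ℂ :=
  ∫ y, Complex.exp (Complex.I * ((inner ℝ ξ y : ℝ) : ℂ)) * F y

/-- On a line of direction v the exponential is constant, because ξ ⊥ v, and ⟨v, y⟩ is affine in s.
Each line integral is therefore a combination of moments of order at most k. -/
theorem integral_exp_mul_inner_pow_mul_eq_zero {F : E → ℂ} (hF : Continuous F)
    (hc : HasCompactSupport F) {v : E} (hv : v ≠ 0) {m : ℕ}
    (h : ∀ p, ∫ s : ℝ, ((s ^ m : ℝ) : ℂ) * F (p + s • v) = 0) {k : ℕ} (hk : k ≤ m)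
    {ξ : E} (hξ : inner ℝ ξ v = 0) :
    ∫ y, Complex.exp (Complex.I * ((inner ℝ ξ y : ℝ) : ℂ)) * ((inner ℝ v y : ℝ) : ℂ) ^ k * F y
      = 0 := by
  refine integral_eq_zero_of_line_integrals (by fun_prop) hc.mul_left hv fun p => ?_
  have hexp : ∀ s : ℝ, Complex.exp (Complex.I * ((inner ℝ ξ (p + s • v) : ℝ) : ℂ)) *
      ((inner ℝ v (p + s • v) : ℝ) : ℂ) ^ k * F (p + s • v) =
      ∑ j ∈ Finset.range (k + 1), ((s ^ j : ℝ) : ℂ) * F (p + s • v) *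
        (Complex.exp (Complex.I * ((inner ℝ ξ p : ℝ) : ℂ)) *
          (((inner ℝ v v : ℝ) : ℂ) ^ j * ((inner ℝ v p : ℝ) : ℂ) ^ (k - j) * (k.choose j : ℂ))) := by
    intro s
    rw [inner_add_right, inner_add_right, inner_smul_right, inner_smul_right, hξ, mul_zero, add_zero,
      Complex.ofReal_add, add_comm ((inner ℝ v p : ℝ) : ℂ), add_pow, Finset.mul_sum, Finset.sum_mul]
    refine Finset.sum_congr rfl fun j _ => ?_
    push_cast
    ring
  simp_rw [hexp]
  rw [integral_finsetSum _ fun j _ => (integrable_pow_mul_line hF hc hv p j).mul_const _]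
  refine Finset.sum_eq_zero fun j hj => ?_
  rw [integral_mul_const, moment_eq_zero_of_le hF hc hv h
    ((Nat.lt_succ_iff.mp (Finset.mem_range.mp hj)).trans hk), zero_mul]

theorem norm_exp_I_mul (a : ℝ) : ‖Complex.exp (Complex.I * (a : ℂ))‖ = 1 := by
  rw [mul_comm]
  exact Complex.norm_exp_ofReal_mul_I a

/-- Vanishing moments along `v` force the Fourier transform to vanish to high order on `v^⊥`. -/
theorem norm_fourierIntegral_le {F : E → ℂ} (hF : Continuous F)
    (hc : HasCompactSupport F) {v : E} (hv : v ≠ 0) {m : ℕ}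
    (h : ∀ p, ∫ s : ℝ, ((s ^ m : ℝ) : ℂ) * F (p + s • v) = 0) (ξ : E)
    (hξ : |inner ℝ ξ v| ≤ ‖v‖) :
    ‖fourierIntegral F ξ‖ ≤ (|inner ℝ ξ v| / ‖v‖) ^ (m + 1) *
      ∫ y, ‖y‖ ^ (m + 1) * Real.exp ‖y‖ * ‖F y‖ := by
  have hv0 : 0 < ‖v‖ := norm_pos_iff.mpr hv
  have hv2 : inner ℝ v v ≠ 0 := by simpa using hv
  set σ : ℝ := inner ℝ ξ v / inner ℝ v v with hσ
  -- The projection of ξ to v^⊥. The remaining factor exp(iσ⟨v, y⟩) is compared with its Taylor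
  -- polynomial of degree m, whose terms integrate to zero by the previous lemma.
  set ξ₀ : E := ξ - σ • v with hξ₀
  have horth : inner ℝ ξ₀ v = 0 := by
    rw [hξ₀, inner_sub_left, real_inner_smul_left, hσ]
    field_simp
    simp
  let z : E → ℂ := fun y => Complex.I * ((σ * inner ℝ v y : ℝ) : ℂ)
  have hz : Continuous z := by fun_prop
  have hznorm : ∀ y, ‖z y‖ ≤ |inner ℝ ξ v| / ‖v‖ * ‖y‖ := by
    intro y
    have h1 : |σ| = |inner ℝ ξ v| / (‖v‖ * ‖v‖) := by
      rw [hσ, abs_div, real_inner_self_eq_norm_mul_norm, abs_mul_self (‖v‖)]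
    calc ‖z y‖ = |σ| * |inner ℝ v y| := by simp [z]
      _ ≤ |σ| * (‖v‖ * ‖y‖) := by gcongr; exact abs_real_inner_le_norm v y
      _ = _ := by rw [h1]; field_simp
  have hsplit : ∀ y, Complex.exp (Complex.I * ((inner ℝ ξ y : ℝ) : ℂ)) =
      Complex.exp (Complex.I * ((inner ℝ ξ₀ y : ℝ) : ℂ)) * Complex.exp (z y) := by
    intro y
    rw [← Complex.exp_add]
    congr 1
    simp only [z, hξ₀, inner_sub_left, real_inner_smul_left]
    push_cast
    ring
  have hint : ∀ {g : E → ℂ}, Continuous g → Integrable fun y => g y * F y := fun hg =>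
    (hg.mul hF).integrable_of_hasCompactSupport hc.mul_left
  have htaylor : ∫ y, Complex.exp (Complex.I * ((inner ℝ ξ₀ y : ℝ) : ℂ)) *
      (∑ k ∈ Finset.range (m + 1), z y ^ k / k.factorial) * F y = 0 := by
    have : ∀ y, Complex.exp (Complex.I * ((inner ℝ ξ₀ y : ℝ) : ℂ)) *
        (∑ k ∈ Finset.range (m + 1), z y ^ k / k.factorial) * F y =
        ∑ k ∈ Finset.range (m + 1), (Complex.I * σ) ^ k / k.factorial *
          (Complex.exp (Complex.I * ((inner ℝ ξ₀ y : ℝ) : ℂ)) * ((inner ℝ v y : ℝ) : ℂ) ^ k * F y) := by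
      intro y
      rw [Finset.mul_sum, Finset.sum_mul]
      refine Finset.sum_congr rfl fun k _ => ?_
      simp only [z]
      push_cast
      ring
    simp_rw [this]
    rw [integral_finsetSum _ fun k _ => (hint (by fun_prop)).const_mul _]
    refine Finset.sum_eq_zero fun k hk => ?_
    rw [integral_const_mul, integral_exp_mul_inner_pow_mul_eq_zero hF hc hv h
      (Nat.lt_succ_iff.mp (Finset.mem_range.mp hk)) horth, mul_zero]
  have hrem : fourierIntegral F ξ = ∫ y, Complex.exp (Complex.I * ((inner ℝ ξ₀ y : ℝ) : ℂ)) *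
      (Complex.exp (z y) - ∑ k ∈ Finset.range (m + 1), z y ^ k / k.factorial) * F y := by
    rw [← sub_zero (fourierIntegral F ξ), ← htaylor, fourierIntegral,
      ← integral_sub (hint (by fun_prop)) (hint (by fun_prop))]
    congr 1
    ext y
    rw [hsplit]
    ring
  rw [hrem, ← integral_const_mul]
  refine norm_integral_le_of_norm_le ?_ (Eventually.of_forall fun y => ?_)
  · refine Integrable.const_mul ?_ _
    refine Continuous.integrable_of_hasCompactSupport (by fun_prop) ?_
    exact hc.norm.mul_left
  · rw [norm_mul, norm_mul, norm_exp_I_mul, one_mul]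
    -- This bounds the exponential in the Taylor remainder by exp ‖y‖, a weight independent of ξ and
    -- v.
    have hq : |inner ℝ ξ v| / ‖v‖ ≤ 1 := (div_le_one hv0).mpr hξ
    have hz1 : ‖z y‖ ≤ ‖y‖ :=
      (hznorm y).trans (mul_le_of_le_one_left (norm_nonneg y) hq)
    calc _ ≤ (‖z y‖ ^ (m + 1) * Real.exp ‖z y‖) * ‖F y‖ := by
          gcongr
          exact Complex.norm_exp_sub_sum_le_norm_mul_exp _ _
      _ ≤ ((|inner ℝ ξ v| / ‖v‖ * ‖y‖) ^ (m + 1) * Real.exp ‖y‖) * ‖F y‖ := by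
          gcongr
          exact hznorm y
      _ = _ := by ring

/-- A continuous compactly supported function whose Fourier transform vanishes on a nonempty
open set is zero. -/
theorem eq_zero_of_fourierIntegral_eventually_zero {F : E → ℂ} (hF : Continuous F)
    (hc : HasCompactSupport F) {ξ₁ : E} (h : ∀ᶠ ξ in 𝓝 ξ₁, fourierIntegral F ξ = 0) : F = 0 := by
  have hint : ∀ {g : E → ℂ}, Continuous g → Integrable fun y => g y * F y := fun hg =>
    (hg.mul hF).integrable_of_hasCompactSupport hc.mul_left
  have hall : ∀ ξ, fourierIntegral F ξ = 0 := by
    intro ξ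
    let a : E → ℂ := fun y => ((inner ℝ ξ₁ y : ℝ) : ℂ)
    let b : E → ℂ := fun y => ((inner ℝ (ξ - ξ₁) y : ℝ) : ℂ)
    have ha : Continuous a := by fun_prop
    have hb : Continuous b := by fun_prop
    -- The transform on the complexified line through ξ₁ and ξ. It is entire, vanishes at small real
    -- z, and takes the value at ξ for z = 1.
    let g : ℂ → ℂ := fun z => ∫ y, Complex.exp (Complex.I * (a y + z * b y)) * F y
    have hg : Differentiable ℂ g := by
      intro z₀
      have hbd : ∀ y, ∀ z ∈ Metric.ball z₀ 1,
          ‖Complex.I * b y * Complex.exp (Complex.I * (a y + z * b y)) * F y‖ ≤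
          ‖b y‖ * Real.exp ((‖z₀‖ + 1) * ‖b y‖) * ‖F y‖ := by
        intro y z hz
        rw [norm_mul, norm_mul, norm_mul, Complex.norm_I, one_mul]
        gcongr
        rw [Complex.norm_exp]
        gcongr
        have hz' : ‖z‖ ≤ ‖z₀‖ + 1 := by
          have := norm_sub_norm_le z z₀
          have h2 : ‖z - z₀‖ < 1 := by simpa [dist_eq_norm] using hz
          linarith
        have hre : (Complex.I * (a y + z * b y)).re = (Complex.I * (z * b y)).re := by
          simp [a, mul_add]
        rw [hre]
        calc _ ≤ ‖Complex.I * (z * b y)‖ := Complex.re_le_norm _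
          _ = ‖z‖ * ‖b y‖ := by simp
          _ ≤ _ := by gcongr
      exact (hasDerivAt_integral_of_dominated_loc_of_deriv_le
        (F := fun z y => Complex.exp (Complex.I * (a y + z * b y)) * F y)
        (F' := fun z y => Complex.I * b y * Complex.exp (Complex.I * (a y + z * b y)) * F y)
        (bound := fun y => ‖b y‖ * Real.exp ((‖z₀‖ + 1) * ‖b y‖) * ‖F y‖)
        (Metric.ball_mem_nhds z₀ one_pos)
        (Eventually.of_forall fun z => (hint (by fun_prop)).aestronglyMeasurable)
        (hint (by fun_prop)) (hint (by fun_prop)).aestronglyMeasurable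
        (Eventually.of_forall hbd)
        (Continuous.integrable_of_hasCompactSupport (by fun_prop) hc.norm.mul_left)
        (Eventually.of_forall fun y z _ => by
          have h1 : HasDerivAt (fun z : ℂ => Complex.I * (a y + z * b y)) (Complex.I * b y) z := by
            have := (((hasDerivAt_id z).mul_const (b y)).const_add (a y)).const_mul Complex.I
            simpa using this
          have := h1.cexp.mul_const (F y)
          rwa [mul_comm (Complex.exp _) (Complex.I * b y)] at this)).2.differentiableAt
    have hgreal : ∀ t : ℝ, g t = fourierIntegral F (ξ₁ + t • (ξ - ξ₁)) := by
      intro t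
      simp only [g, fourierIntegral, a, b, inner_add_left, real_inner_smul_left]
      push_cast
      rfl
    have han : AnalyticOnNhd ℂ g Set.univ := fun z _ => hg.analyticAt z
    have hev : ∀ᶠ t : ℝ in 𝓝 0, g t = 0 := by
      have ht : Tendsto (fun t : ℝ => ξ₁ + t • (ξ - ξ₁)) (𝓝 0) (𝓝 ξ₁) := by
        have : Continuous fun t : ℝ => ξ₁ + t • (ξ - ξ₁) := by fun_prop
        simpa using this.tendsto 0
      filter_upwards [ht.eventually h] with t ht
      rw [hgreal, ht]
    have hfreq : ∃ᶠ z in 𝓝[≠] (0 : ℂ), g z = (0 : ℂ → ℂ) z := by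
      have ht : Tendsto (fun t : ℝ => (t : ℂ)) (𝓝[≠] 0) (𝓝[≠] 0) := by
        refine tendsto_nhdsWithin_iff.mpr ⟨?_, ?_⟩
        · exact (Complex.continuous_ofReal.tendsto' 0 0 rfl).mono_left nhdsWithin_le_nhds
        · filter_upwards [self_mem_nhdsWithin] with t ht
          simpa using ht
      exact ht.frequently (hev.filter_mono nhdsWithin_le_nhds).frequently
    have hg0 := han.eq_of_frequently_eq (g := 0) (fun z _ => analyticAt_const) hfreq
    have := hgreal 1
    rw [hg0] at this
    simpa using this.symm
  have hfour : 𝓕 F = 0 := by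
    ext w
    rw [Real.fourier_eq']
    have := hall ((-2 * Real.pi) • w)
    rw [fourierIntegral] at this
    rw [Pi.zero_apply, ← this]
    congr 1
    ext y
    rw [real_inner_smul_left, real_inner_comm, smul_eq_mul]
    congr 2
    push_cast
    ring
  have hinv := hF.fourierInv_fourier_eq (hF.integrable_of_hasCompactSupport hc)
    (by rw [hfour]; exact integrable_zero _ _ _)
  rw [← hinv, hfour]
  ext w
  simp [Real.fourierInv_eq']

end Scalar

end MLRT

namespace MLRT

open MvPolynomial

/-! ### Symmetric tensors as homogeneous polynomials -/

section Algebra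

variable {n m : ℕ}

/-- The value `∑ T_{i_1 … i_m} x_{i_1} ⋯ x_{i_m}` of the form of degree `m` attached to `T`. -/
noncomputable def contract (T : Tensor n m) (x : Spacetime n) : ℂ :=
  ∑ i : Fin m → Fin (n + 1), ((∏ j, x (i j) : ℝ) : ℂ) * T i

/-- The form of degree `m` attached to a tensor of rank `m`. -/
noncomputable def toPoly : Tensor n m →ₗ[ℂ] MvPolynomial (Fin (n + 1)) ℂ where
  toFun T := ∑ i : Fin m → Fin (n + 1), C (T i) * ∏ j, X (i j)
  map_add' S T := by simp [add_mul, Finset.sum_add_distrib]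
  map_smul' a T := by simp [Finset.smul_sum, smul_eq_C_mul, mul_assoc]

theorem toPoly_apply (T : Tensor n m) :
    toPoly T = ∑ i : Fin m → Fin (n + 1), C (T i) * ∏ j, X (i j) := rfl

theorem eval_toPoly (T : Tensor n m) (x : Spacetime n) :
    eval (fun k => (x k : ℂ)) (toPoly T) = contract T x := by
  simp [toPoly_apply, contract, mul_comm]

theorem toPoly_isHomogeneous (T : Tensor n m) : (toPoly T).IsHomogeneous m := by
  refine IsHomogeneous.sum _ _ _ fun i _ => ?_
  have h : (∏ j, (X (i j) : MvPolynomial (Fin (n + 1)) ℂ)).IsHomogeneous (∑ _j : Fin m, 1) :=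
    IsHomogeneous.prod _ _ _ fun j _ => isHomogeneous_X ℂ (i j)
  simpa using (isHomogeneous_C _ (T i)).mul h

/-- The exponent of the monomial `∏ X_{i_j}`. -/
noncomputable def exponent (i : Fin m → Fin (n + 1)) : Fin (n + 1) →₀ ℕ :=
  ∑ j, Finsupp.single (i j) 1

theorem prod_X_eq_monomial (i : Fin m → Fin (n + 1)) :
    ∏ j, (X (i j) : MvPolynomial (Fin (n + 1)) ℂ) = monomial (exponent i) 1 := by
  rw [exponent, monomial_sum_one]; rfl

theorem exponent_comp_perm (i : Fin m → Fin (n + 1)) (π : Equiv.Perm (Fin m)) :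
    exponent (i ∘ π) = exponent i :=
  Equiv.sum_comp π fun j => Finsupp.single (i j) 1

/-- The exponent records the cardinalities of the fibres; bijections between corresponding fibres
glue to a permutation. -/
theorem exists_perm_of_exponent_eq {i i' : Fin m → Fin (n + 1)} (h : exponent i = exponent i') :
    ∃ π : Equiv.Perm (Fin m), i = i' ∘ π := by
  have hcard : ∀ (i : Fin m → Fin (n + 1)) k, exponent i k = Fintype.card {j // i j = k} := by
    intro i k
    rw [exponent, Finsupp.finsetSum_apply, Fintype.card_subtype, Finset.card_filter]
    exact Finset.sum_congr rfl fun j _ => Finsupp.single_apply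
  have e : ∀ k, Nonempty ({j // i j = k} ≃ {j // i' j = k}) := fun k =>
    ⟨Fintype.equivOfCardEq (by rw [← hcard, ← hcard, h])⟩
  exact ⟨Equiv.ofFiberEquiv fun k => (e k).some, by
    funext j
    exact (Equiv.ofFiberEquiv_map (g := i') (fun k => (e k).some) j).symm⟩

theorem exists_exponent_eq : ∀ (m : ℕ) (d : Fin (n + 1) →₀ ℕ), d.degree = m →
    ∃ i : Fin m → Fin (n + 1), exponent i = d := by
  intro m
  induction m with
  | zero =>
    intro d hd
    exact ⟨Fin.elim0, by simp [exponent, (Finsupp.degree_eq_zero_iff d).mp hd]⟩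
  | succ m ih =>
    intro d hd
    have hd0 : d ≠ 0 := by
      rintro rfl
      simp at hd
    obtain ⟨k, hk⟩ := Finsupp.ne_iff.mp hd0
    have hle : Finsupp.single k 1 ≤ d := by
      rw [Finsupp.single_le_iff]
      exact Nat.one_le_iff_ne_zero.mpr hk
    have hsum : Finsupp.single k 1 + (d - Finsupp.single k 1) = d := add_tsub_cancel_of_le hle
    obtain ⟨i, hi⟩ := ih (d - Finsupp.single k 1) (by
      have := congrArg Finsupp.degree hsum
      rw [map_add, Finsupp.degree_single, hd] at this
      omega)
    refine ⟨Fin.cons k i, ?_⟩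
    rw [← hsum, ← hi, exponent, Fin.sum_univ_succ]
    simp [exponent]

theorem coeff_toPoly (T : Tensor n m) (d : Fin (n + 1) →₀ ℕ) :
    coeff d (toPoly T) = ∑ i : Fin m → Fin (n + 1), if exponent i = d then T i else 0 := by
  classical
  rw [toPoly_apply, coeff_sum]
  refine Finset.sum_congr rfl fun i _ => ?_
  rw [prod_X_eq_monomial, coeff_C_mul, coeff_monomial]
  simp

/-- The number of index tuples with a given exponent. -/
noncomputable def multiplicity (n m : ℕ) (d : Fin (n + 1) →₀ ℕ) : ℕ :=
  (Finset.univ.filter fun i : Fin m → Fin (n + 1) => exponent i = d).card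

theorem multiplicity_exponent_ne_zero (i : Fin m → Fin (n + 1)) :
    (multiplicity n m (exponent i) : ℂ) ≠ 0 :=
  Nat.cast_ne_zero.mpr (Finset.card_pos.mpr ⟨i, by simp⟩).ne'

/-- Tuples with equal exponent form one permutation orbit, on which a symmetric tensor is constant.
Each coefficient is thus a component times the nonzero size of its orbit; dividing by that size
gives the inverse below. -/
theorem toPoly_injOn : Set.InjOn (toPoly (n := n) (m := m)) (symTensor n m) := by
  intro S hS T hT hST
  rw [← sub_eq_zero, ← map_sub] at hST
  have hU := (symTensor n m).sub_mem hS hT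
  ext i
  have h := coeff_toPoly (S - T) (exponent i)
  rw [hST, coeff_zero, ← Finset.sum_filter, Finset.sum_congr rfl (g := fun _ => (S - T) i),
    Finset.sum_const, nsmul_eq_mul] at h
  · exact sub_eq_zero.mp ((mul_eq_zero.mp h.symm).resolve_left (multiplicity_exponent_ne_zero i))
  · intro i' hi'
    obtain ⟨π, rfl⟩ := exists_perm_of_exponent_eq (Finset.mem_filter.mp hi').2
    exact hU π i

theorem exists_toPoly_eq {P : MvPolynomial (Fin (n + 1)) ℂ} (hP : P.IsHomogeneous m) :
    ∃ T ∈ symTensor n m, toPoly T = P := by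
  refine ⟨fun i => coeff (exponent i) P / multiplicity n m (exponent i), fun π i => ?_, ?_⟩
  · simp only [exponent_comp_perm]
  · ext d
    rw [coeff_toPoly, ← Finset.sum_filter, Finset.sum_congr rfl
      (g := fun _ => coeff d P / multiplicity n m d), Finset.sum_const, nsmul_eq_mul]
    · by_cases hd : d.degree = m
      · obtain ⟨i, rfl⟩ := exists_exponent_eq m d hd
        exact mul_div_cancel₀ _ (multiplicity_exponent_ne_zero i)
      · rw [hP.coeff_eq_zero hd, zero_div, mul_zero]
    · intro i hi
      rw [(Finset.mem_filter.mp hi).2]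

/-- Commuting variables do not see the symmetrization: all m! permutations contribute the same
product, cancelling the factor 1/m!. -/
theorem toPoly_symMul (hm : 2 ≤ m) (v : Tensor n 2) (u : Tensor n (m - 2)) :
    toPoly (symMul hm v u) = toPoly v * toPoly u := by
  obtain ⟨k, rfl⟩ : ∃ k, m = k + 2 := ⟨m - 2, by omega⟩
  change Tensor n k at u
  let P : (Fin (k + 2) → Fin (n + 1)) → MvPolynomial (Fin (n + 1)) ℂ := fun i => ∏ j, X (i j)
  let w : (Fin (k + 2) → Fin (n + 1)) → ℂ := fun i =>
    u (fun j => i (Fin.castAdd 2 j)) * v (fun j => i (Fin.natAdd k j))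
  have hw : ∀ i, symMul hm v u i =
      ((Nat.factorial (k + 2) : ℕ) : ℂ)⁻¹ * ∑ π : Equiv.Perm (Fin (k + 2)), w (i ∘ π) := by
    intro i
    rw [symMul]
    congr 1
    refine Finset.sum_congr rfl fun π _ => ?_
    simp only [w, Function.comp]
    congr 2
    ext j
    fin_cases j <;> rfl
  have hperm : ∀ π : Equiv.Perm (Fin (k + 2)), ∑ i, C (w (i ∘ π)) * P i = ∑ i, C (w i) * P i := by
    intro π
    refine Fintype.sum_equiv (Equiv.arrowCongr π.symm (Equiv.refl _)) _ _ fun i => ?_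
    have : (Equiv.arrowCongr π.symm (Equiv.refl (Fin (n + 1)))) i = i ∘ π := by
      ext j
      simp [Equiv.arrowCongr]
    rw [this]
    congr 1
    exact (Equiv.prod_comp π fun j => X (i j)).symm
  have hsplit : ∑ i, C (w i) * P i = toPoly v * toPoly u := by
    rw [toPoly_apply, toPoly_apply, Finset.sum_mul_sum, ← Finset.sum_product',
      Finset.univ_product_univ]
    refine Fintype.sum_equiv ((Equiv.arrowCongr finSumFinEquiv.symm (Equiv.refl _)).trans
      ((Equiv.sumArrowEquivProdArrow _ _ _).trans (Equiv.prodComm _ _))) _ _ fun i => ?_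
    have hP : P i = (∏ j, X (i (Fin.castAdd 2 j))) * ∏ j, X (i (Fin.natAdd k j)) :=
      Fin.prod_univ_add _
    have h1 : ((Equiv.arrowCongr finSumFinEquiv.symm (Equiv.refl (Fin (n + 1)))).trans
        ((Equiv.sumArrowEquivProdArrow (Fin k) (Fin 2) _).trans (Equiv.prodComm _ _))) i =
        (fun j => i (Fin.natAdd k j), fun j => i (Fin.castAdd 2 j)) := by
      ext j <;> simp [Equiv.arrowCongr, Equiv.sumArrowEquivProdArrow]
    rw [h1, hP]
    simp only [w, map_mul]
    ring
  rw [toPoly_apply]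
  simp_rw [hw, map_mul, map_sum, mul_assoc, ← Finset.mul_sum, Finset.sum_mul]
  rw [Finset.sum_comm]
  change C _ * ∑ π : Equiv.Perm (Fin (k + 2)), ∑ i, C (w (i ∘ π)) * P i = _
  simp_rw [hperm, hsplit]
  rw [Finset.sum_const, Finset.card_univ, Fintype.card_perm, Fintype.card_fin, nsmul_eq_mul,
    ← mul_assoc, ← map_natCast (C : ℂ →+* MvPolynomial (Fin (n + 1)) ℂ), ← C_mul,
    inv_mul_cancel₀ (Nat.cast_ne_zero.mpr (Nat.factorial_ne_zero _)), C_1, one_mul]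

theorem contract_symMul (hm : 2 ≤ m) (v : Tensor n 2) (u : Tensor n (m - 2)) (x : Spacetime n) :
    contract (symMul hm v u) x = contract v x * contract u x := by
  simp_rw [← eval_toPoly, toPoly_symMul, map_mul]

theorem symMul_mem_symTensor (hm : 2 ≤ m) (v : Tensor n 2) (u : Tensor n (m - 2)) :
    symMul hm v u ∈ symTensor n m := by
  intro σ i
  simp only [symMul, Function.comp]
  congr 1
  exact Fintype.sum_equiv (Equiv.mulLeft σ) _ _ fun π => rfl

/-- Multiplication by `v` as a linear map. -/
noncomputable def symMulLin (hm : 2 ≤ m) (v : Tensor n 2) :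
    symTensor n (m - 2) →ₗ[ℂ] Tensor n m where
  toFun u := symMul hm v u
  map_add' u u' := by
    ext i
    simp [symMul, add_mul, Finset.sum_add_distrib, mul_add]
  map_smul' a u := by
    ext i
    simp only [symMul, SetLike.val_smul, Pi.smul_apply, smul_eq_mul, RingHom.id_apply,
      Finset.mul_sum]
    exact Finset.sum_congr rfl fun π _ => by ring

/-- The quadratic form `-c² x_0² + x_1² + ⋯ + x_n²` of the Minkowski metric. -/
theorem toPoly_minkowski (c : ℝ) : toPoly (minkowski n c) =
    -C ((c : ℂ) ^ 2) * X 0 ^ 2 + ∑ j : Fin n, X j.succ ^ 2 := by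
  rw [toPoly_apply, ← (finTwoArrowEquiv (Fin (n + 1))).symm.sum_comp, Fintype.sum_prod_type]
  have : ∀ a b : Fin (n + 1), C (minkowski n c ((finTwoArrowEquiv (Fin (n + 1))).symm (a, b))) *
      ∏ j, (X ((finTwoArrowEquiv (Fin (n + 1))).symm (a, b) j) : MvPolynomial (Fin (n + 1)) ℂ) =
      if a = b then C (if a = 0 then -((c : ℂ) ^ 2) else 1) * X a ^ 2 else 0 := by
    intro a b
    simp only [minkowski, finTwoArrowEquiv_symm_apply, Fin.prod_univ_two, Matrix.cons_val_zero,
      Matrix.cons_val_one]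
    split_ifs with h <;> simp [h, pow_two]
  simp_rw [this, Finset.sum_ite_eq, Finset.mem_univ, if_true]
  rw [Fin.sum_univ_succ]
  simp

theorem contract_minkowski (c : ℝ) (x : Spacetime n) :
    contract (minkowski n c) x = ((-(c * x 0) ^ 2 + ∑ j : Fin n, x j.succ ^ 2 : ℝ) : ℂ) := by
  rw [← eval_toPoly, toPoly_minkowski]
  simp [mul_pow]

/-! ### Divisibility by the Minkowski form -/

theorem eq_zero_of_eval_real_eq_zero {σ : Type*} {P : MvPolynomial σ ℂ}
    (h : ∀ y : σ → ℝ, eval (fun j => (y j : ℂ)) P = 0) : P = 0 := by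
  refine funext_set (fun _ => Set.range Complex.ofReal)
    (fun _ => Set.infinite_range_of_injective Complex.ofReal_injective) fun x hx => ?_
  choose y hy using fun j => hx j trivial
  rw [map_zero, ← h y]
  congr
  ext j
  exact (hy j).symm

/-- A polynomial vanishing on the real light cone is divisible by the Minkowski form. -/
theorem minkowski_dvd_of_vanishes_on_cone (hn : 0 < n) {c : ℝ} (hc : 0 < c)
    {P : MvPolynomial (Fin (n + 1)) ℂ}
    (h : ∀ x : Spacetime n, x 0 ^ 2 = c ^ 2 * ∑ j : Fin n, x j.succ ^ 2 →
      eval (fun k => (x k : ℂ)) P = 0) :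
    toPoly (minkowski n (1 / c)) ∣ P := by
  set r : MvPolynomial (Fin n) ℂ := C ((c : ℂ) ^ 2) * ∑ j, X j ^ 2 with hr
  -- Up to the unit -c⁻², the Minkowski form is monic quadratic in X_0, so division with remainder A
  -- X_0 + B is available.
  set q : Polynomial (MvPolynomial (Fin n) ℂ) := Polynomial.X ^ 2 - Polynomial.C r with hq
  have hc' : (c : ℂ) ≠ 0 := by exact_mod_cast hc.ne'
  have hqm : q.Monic := Polynomial.monic_X_pow_sub_C r two_ne_zero
  have hqQ : finSuccEquiv ℂ n (toPoly (minkowski n (1 / c))) =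
      q * Polynomial.C (-C (((c : ℂ) ^ 2)⁻¹)) := by
    have h1 : (C (((c : ℂ) ^ 2)⁻¹) : MvPolynomial (Fin n) ℂ) * r = ∑ j, X j ^ 2 := by
      rw [hr, ← mul_assoc, ← C_mul, inv_mul_cancel₀ (pow_ne_zero 2 hc'), C_1, one_mul]
    have h2 : (((1 / c : ℝ) : ℂ)) ^ 2 = ((c : ℂ) ^ 2)⁻¹ := by
      push_cast
      rw [one_div, inv_pow]
    have h3 : finSuccEquiv ℂ n (C (((c : ℂ) ^ 2)⁻¹)) = Polynomial.C (C (((c : ℂ) ^ 2)⁻¹)) :=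
      (finSuccEquiv ℂ n).commutes _
    rw [toPoly_minkowski, hq, sub_mul, ← Polynomial.C_mul, mul_neg, mul_comm r, h1, h2]
    simp only [map_add, map_mul, map_neg, map_sum, map_pow, finSuccEquiv_X_zero,
      finSuccEquiv_X_succ, h3]
    ring
  set e := finSuccEquiv ℂ n P with he
  have hdeg : (e %ₘ q).natDegree ≤ 1 := by
    have hq2 : q.natDegree = 2 := Polynomial.natDegree_X_pow_sub_C
    have := Polynomial.natDegree_modByMonic_lt e hqm (by
      intro h1
      rw [h1, Polynomial.natDegree_one] at hq2
      omega)
    omega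
  obtain ⟨A, B, hAB⟩ := Polynomial.exists_eq_X_add_C_of_natDegree_le_one hdeg
  have hdiv : e = Polynomial.C A * Polynomial.X + Polynomial.C B + q * (e /ₘ q) := by
    rw [← hAB, Polynomial.modByMonic_add_div]
  have heval : ∀ (y : Fin n → ℝ) (t : ℝ), t ^ 2 = c ^ 2 * ∑ j, y j ^ 2 →
      eval (fun j => (y j : ℂ)) A * t + eval (fun j => (y j : ℂ)) B = 0 := by
    intro y t ht
    have h1 := h (WithLp.toLp 2 (Fin.cons t y : Fin (n + 1) → ℝ)) (by simpa using ht)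
    have h2 : (fun k => (((WithLp.toLp 2 (Fin.cons t y : Fin (n + 1) → ℝ) : Spacetime n) k : ℝ) : ℂ))
        = (Fin.cons (t : ℂ) (fun j => (y j : ℂ)) : Fin (n + 1) → ℂ) := by
      ext k
      refine Fin.cases ?_ (fun j => ?_) k <;> simp
    have h3 : (t : ℂ) ^ 2 = (c : ℂ) ^ 2 * ∑ j, (y j : ℂ) ^ 2 := by exact_mod_cast ht
    rw [h2, eval_eq_eval_mv_eval', ← he, hdiv] at h1
    have h4 : Polynomial.eval (t : ℂ) (Polynomial.map (eval fun j => (y j : ℂ)) q) = 0 := by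
      have hry : eval (fun j => (y j : ℂ)) r = (t : ℂ) ^ 2 := by
        rw [hr, h3]
        simp
      rw [hq, Polynomial.map_sub, Polynomial.map_pow, Polynomial.map_X, Polynomial.map_C, hry]
      simp
    rw [Polynomial.map_add, Polynomial.map_mul, Polynomial.eval_add, Polynomial.eval_mul, h4,
      zero_mul, add_zero] at h1
    simpa using h1
  -- The remainder vanishes at both roots ±t over y, so B(y) = 0 and A(y) t = 0. Multiplying by t
  -- turns the latter into a polynomial identity and covers t = 0.
  have hAB0 : ∀ y : Fin n → ℝ, eval (fun j => (y j : ℂ)) (A * ∑ j, X j ^ 2) = 0 ∧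
      eval (fun j => (y j : ℂ)) B = 0 := by
    intro y
    have hS : 0 ≤ ∑ j, y j ^ 2 := Finset.sum_nonneg fun j _ => sq_nonneg _
    set t := c * Real.sqrt (∑ j, y j ^ 2) with ht
    have ht2 : t ^ 2 = c ^ 2 * ∑ j, y j ^ 2 := by rw [ht, mul_pow, Real.sq_sqrt hS]
    have h1 := heval y t ht2
    have h2 := heval y (-t) (by rw [neg_sq, ht2])
    have hB : eval (fun j => (y j : ℂ)) B = 0 := by
      push_cast at h2
      linear_combination (h1 + h2) / 2
    refine ⟨?_, hB⟩
    rw [hB, add_zero] at h1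
    have h3 : (t : ℂ) ^ 2 = (c : ℂ) ^ 2 * ∑ j, (y j : ℂ) ^ 2 := by exact_mod_cast ht2
    have h4 : (c : ℂ) ^ 2 * eval (fun j => (y j : ℂ)) (A * ∑ j, X j ^ 2) = 0 := by
      simp only [map_mul, map_sum, map_pow, eval_X]
      linear_combination (t : ℂ) * h1 - eval (fun j => (y j : ℂ)) A * h3
    exact (mul_eq_zero.mp h4).resolve_left (pow_ne_zero 2 hc')
  have hB : B = 0 := eq_zero_of_eval_real_eq_zero fun y => (hAB0 y).2
  have hr0 : (∑ j, X j ^ 2 : MvPolynomial (Fin n) ℂ) ≠ 0 := by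
    intro h0
    have := congrArg (eval fun _ => (1 : ℂ)) h0
    simp at this
    omega
  have hA : A = 0 :=
    (mul_eq_zero.mp (eq_zero_of_eval_real_eq_zero fun y => (hAB0 y).1)).resolve_right hr0
  have hu : IsUnit (Polynomial.C (-C (((c : ℂ) ^ 2)⁻¹)) : Polynomial (MvPolynomial (Fin n) ℂ)) :=
    (((IsUnit.mk0 _ (inv_ne_zero (pow_ne_zero 2 hc'))).map C).neg).map Polynomial.C
  have hd : finSuccEquiv ℂ n (toPoly (minkowski n (1 / c))) ∣ finSuccEquiv ℂ n P := by
    rw [hqQ, hu.mul_right_dvd, ← he, hdiv, hA, hB]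
    simp
  exact (map_dvd_iff (finSuccEquiv ℂ n)).mp hd

/-- Compare the parts of degree m. The quotient H produced by divisibility need not be homogeneous.
-/
theorem eq_mul_homogeneousComponent {σ : Type*} {a m : ℕ} {P Q H : MvPolynomial σ ℂ}
    (hP : P.IsHomogeneous m) (hQ : Q.IsHomogeneous a) (h : P = Q * H) (ham : a ≤ m) :
    P = Q * homogeneousComponent (m - a) H := by
  let _ := gradedAlgebra (σ := σ) (R := ℂ)
  have h1 := DirectSum.coe_decompose_mul_of_left_mem_of_le
    (homogeneousSubmodule σ ℂ) (b := H) hQ ham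
  rw [← h, DirectSum.decompose_of_mem_same (homogeneousSubmodule σ ℂ) hP] at h1
  exact h1.trans (congrArg (Q * ·) (decomposition.decompose'_apply H _))

theorem eq_zero_of_homogeneous_dvd {σ : Type*} {a m : ℕ} {P Q H : MvPolynomial σ ℂ}
    (hP : P.IsHomogeneous m) (hQ : Q.IsHomogeneous a) (h : P = Q * H) (ham : m < a) : P = 0 := by
  let _ := gradedAlgebra (σ := σ) (R := ℂ)
  have h1 := DirectSum.coe_decompose_mul_of_left_mem_of_not_le
    (homogeneousSubmodule σ ℂ) (b := H) hQ ham.not_ge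
  rwa [← h, DirectSum.decompose_of_mem_same (homogeneousSubmodule σ ℂ) hP] at h1

/-- The symmetric tensors vanishing on the light cone are the multiples of the metric. -/
theorem exists_symMul_of_vanishes_on_cone (hn : 0 < n) {c : ℝ} (hc : 0 < c) (hm : 2 ≤ m)
    {T : Tensor n m} (hT : T ∈ symTensor n m)
    (h : ∀ x : Spacetime n, x 0 ^ 2 = c ^ 2 * ∑ j : Fin n, x j.succ ^ 2 → contract T x = 0) :
    ∃ u ∈ symTensor n (m - 2), symMul hm (minkowski n (1 / c)) u = T := by
  obtain ⟨H, hH⟩ := minkowski_dvd_of_vanishes_on_cone hn hc (P := toPoly T)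
    fun x hx => by rw [eval_toPoly, h x hx]
  obtain ⟨u, hu, huH⟩ := exists_toPoly_eq (homogeneousComponent_isHomogeneous (m - 2) H)
  refine ⟨u, hu, toPoly_injOn (symMul_mem_symTensor _ _ _) hT ?_⟩
  rw [toPoly_symMul, huH]
  exact (eq_mul_homogeneousComponent (toPoly_isHomogeneous T) (toPoly_isHomogeneous _) hH hm).symm

theorem eq_zero_of_vanishes_on_cone (hn : 0 < n) {c : ℝ} (hc : 0 < c) (hm : m ≤ 1)
    {T : Tensor n m} (hT : T ∈ symTensor n m)
    (h : ∀ x : Spacetime n, x 0 ^ 2 = c ^ 2 * ∑ j : Fin n, x j.succ ^ 2 → contract T x = 0) :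
    T = 0 := by
  obtain ⟨H, hH⟩ := minkowski_dvd_of_vanishes_on_cone hn hc (P := toPoly T)
    fun x hx => by rw [eval_toPoly, h x hx]
  refine toPoly_injOn hT (symTensor n m).zero_mem ?_
  rw [map_zero]
  exact eq_zero_of_homogeneous_dvd (toPoly_isHomogeneous T) (toPoly_isHomogeneous _) hH (by omega)

end Algebra

end MLRT

namespace MLRT

open MeasureTheory Filter Topology Asymptotics

/-! ### Contractions and Fourier transforms of tensor fields -/

section TestFields

variable {n m : ℕ}

theorem IsTestField.continuous {f : Spacetime n → Tensor n m} (hf : IsTestField f) :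
    Continuous f := hf.smooth.continuous

theorem IsTestField.continuous_apply {f : Spacetime n → Tensor n m} (hf : IsTestField f)
    (i : Fin m → Fin (n + 1)) : Continuous fun y => f y i :=
  (_root_.continuous_apply i).comp hf.continuous

theorem IsTestField.hasCompactSupport_apply {f : Spacetime n → Tensor n m} (hf : IsTestField f)
    (i : Fin m → Fin (n + 1)) : HasCompactSupport fun y => f y i :=
  hf.compactSupport.comp_left (g := fun T : Tensor n m => T i) rfl

theorem IsTestField.continuous_contract {f : Spacetime n → Tensor n m} (hf : IsTestField f)
    (x : Spacetime n) : Continuous fun y => contract (f y) x :=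
  continuous_finsetSum _ fun i _ => continuous_const.mul (hf.continuous_apply i)

theorem IsTestField.hasCompactSupport_contract {f : Spacetime n → Tensor n m}
    (hf : IsTestField f) (x : Spacetime n) : HasCompactSupport fun y => contract (f y) x :=
  hf.compactSupport.comp_left (g := fun T : Tensor n m => contract T x) (by simp [contract])

theorem contract_smul (T : Tensor n m) (a : ℝ) (x : Spacetime n) :
    contract T (a • x) = (a : ℂ) ^ m * contract T x := by
  simp only [contract, Finset.mul_sum, PiLp.smul_apply, smul_eq_mul, Finset.prod_mul_distrib,
    Finset.prod_const, Finset.card_univ, Fintype.card_fin]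
  refine Finset.sum_congr rfl fun i _ => ?_
  push_cast
  ring

theorem norm_contract_le (T : Tensor n m) (x : Spacetime n) :
    ‖contract T x‖ ≤ ‖x‖ ^ m * ∑ i, ‖T i‖ := by
  rw [Finset.mul_sum]
  refine (norm_sum_le _ _).trans (Finset.sum_le_sum fun i _ => ?_)
  rw [norm_mul, Complex.norm_real, norm_prod]
  gcongr
  calc ∏ j, ‖x (i j)‖ ≤ ∏ _j : Fin m, ‖x‖ :=
        Finset.prod_le_prod (fun j _ => norm_nonneg _) fun j _ => PiLp.norm_apply_le x (i j)
    _ = ‖x‖ ^ m := by simp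

theorem momentumLightRay_eq_integral {f : Spacetime n → Tensor n m} (hf : IsTestField f) {c : ℝ}
    (k : ℕ) (p : Spacetime n) {ω : EuclideanSpace ℝ (Fin n)} (hω : direction c ω ≠ 0) :
    momentumLightRay c k f p ω =
      ∫ s : ℝ, ((s ^ k : ℝ) : ℂ) * contract (f (p + s • direction c ω)) (direction c ω) := by
  simp_rw [contract, Finset.mul_sum]
  rw [integral_finsetSum]
  · refine Finset.sum_congr rfl fun i _ => ?_
    rw [← integral_const_mul]
    congr 1
    ext s
    ring
  · intro i _
    have := (integrable_pow_mul_line (hf.continuous_apply i) (hf.hasCompactSupport_apply i) hω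
      p k).const_mul ((∏ j, direction c ω (i j) : ℝ) : ℂ)
    refine this.congr (Eventually.of_forall fun s => ?_)
    ring

/-- The Fourier transform of a tensor field. -/
noncomputable def fourierTensor (f : Spacetime n → Tensor n m) (ξ : Spacetime n) : Tensor n m :=
  fun i => fourierIntegral (fun y => f y i) ξ

theorem contract_fourierTensor {f : Spacetime n → Tensor n m} (hf : IsTestField f)
    (ξ x : Spacetime n) :
    contract (fourierTensor f ξ) x = fourierIntegral (fun y => contract (f y) x) ξ := by
  simp_rw [fourierIntegral, contract, fourierTensor, Finset.mul_sum]
  rw [integral_finsetSum]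
  · refine Finset.sum_congr rfl fun i _ => ?_
    rw [fourierIntegral, ← integral_const_mul]
    congr 1
    ext y
    ring
  · intro i _
    have := hf.continuous_apply i
    exact Continuous.integrable_of_hasCompactSupport (by fun_prop)
      (hf.hasCompactSupport_apply i).mul_left.mul_left

end TestFields

/-! ### Forms restricted to conics -/

section Curves

variable {n m : ℕ}

/-- The bound forces a root at 0. Away from t = 0 one factor t cancels from both sides, which drives
the induction. -/
theorem X_pow_dvd_of_isBigO {M : ℕ} {A : Polynomial ℂ}
    (h : (fun t : ℝ => A.eval (t : ℂ)) =O[𝓝[≠] 0] fun t : ℝ => t ^ M) : Polynomial.X ^ M ∣ A := by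
  induction M generalizing A with
  | zero => simp
  | succ M ih =>
    have hcont : Continuous fun t : ℝ => A.eval (t : ℂ) := A.continuous.comp Complex.continuous_ofReal
    have h0 : A.eval 0 = 0 := by
      have h1 : Tendsto (fun t : ℝ => A.eval (t : ℂ)) (𝓝[≠] 0) (𝓝 (A.eval 0)) := by
        simpa using (hcont.tendsto 0).mono_left nhdsWithin_le_nhds
      have h2 : Tendsto (fun t : ℝ => t ^ (M + 1)) (𝓝[≠] 0) (𝓝 0) := by
        have : Continuous fun t : ℝ => t ^ (M + 1) := by fun_prop
        simpa using (this.tendsto 0).mono_left nhdsWithin_le_nhds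
      exact tendsto_nhds_unique h1 (h.trans_tendsto h2)
    obtain ⟨B, rfl⟩ : Polynomial.X ∣ A := by
      rwa [Polynomial.X_dvd_iff, Polynomial.coeff_zero_eq_eval_zero]
    rw [pow_succ']
    refine mul_dvd_mul_left _ (ih ?_)
    obtain ⟨K, hK⟩ := h.bound
    refine IsBigO.of_bound K ?_
    filter_upwards [hK, self_mem_nhdsWithin] with t ht ht0
    have hpos : 0 < ‖t‖ := norm_pos_iff.mpr ht0
    rw [Polynomial.eval_mul, Polynomial.eval_X, norm_mul, Complex.norm_real, pow_succ', norm_mul]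
      at ht
    refine le_of_mul_le_mul_left (ht.trans_eq ?_) hpos
    ring

/-- The form `T` along the curve `t ↦ p + t q + t² r`, as a polynomial in `t`. -/
noncomputable def curvePoly (T : Tensor n m) (p q r : Spacetime n) : Polynomial ℂ :=
  ∑ i : Fin m → Fin (n + 1), Polynomial.C (T i) * ∏ j, (Polynomial.C (p (i j) : ℂ) +
    Polynomial.C (q (i j) : ℂ) * Polynomial.X + Polynomial.C (r (i j) : ℂ) * Polynomial.X ^ 2)

theorem eval_curvePoly (T : Tensor n m) (p q r : Spacetime n) (t : ℝ) :
    (curvePoly T p q r).eval (t : ℂ) = contract T (p + t • q + t ^ 2 • r) := by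
  simp only [curvePoly, contract, Polynomial.eval_finsetSum, Polynomial.eval_mul,
    Polynomial.eval_prod, Polynomial.eval_add, Polynomial.eval_C, Polynomial.eval_X,
    Polynomial.eval_pow, PiLp.add_apply, PiLp.smul_apply, smul_eq_mul]
  refine Finset.sum_congr rfl fun i _ => ?_
  rw [mul_comm]
  congr 1
  push_cast
  exact Finset.prod_congr rfl fun j _ => by ring

theorem natDegree_curvePoly_le (T : Tensor n m) (p q r : Spacetime n) :
    (curvePoly T p q r).natDegree ≤ 2 * m := by
  refine Polynomial.natDegree_sum_le_of_forall_le _ _ fun i _ => ?_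
  refine (Polynomial.natDegree_C_mul_le _ _).trans ((Polynomial.natDegree_prod_le _ _).trans ?_)
  calc _ ≤ ∑ _j : Fin m, 2 := Finset.sum_le_sum fun j _ => by compute_degree
    _ = 2 * m := by simp [mul_comm]

/-- Homogeneity applied to r + tq + t²p = t²(p + t⁻¹q + t⁻²r) yields the factor t^{2m}: exchanging
the ends of the conic reverses the coefficients. -/
theorem curvePoly_reflect (T : Tensor n m) (p q r : Spacetime n) :
    curvePoly T r q p = Polynomial.reflect (2 * m) (curvePoly T p q r) := by
  refine Polynomial.eq_of_infinite_eval_eq _ _ ?_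
  refine ((Set.infinite_range_of_injective Complex.ofReal_injective).sdiff
    (Set.finite_singleton 0)).mono ?_
  rintro _ ⟨⟨t, rfl⟩, ht⟩
  have ht0 : t ≠ 0 := by simpa using ht
  have h1 : r + t • q + t ^ 2 • p = t ^ 2 • (p + t⁻¹ • q + t⁻¹ ^ 2 • r) := by
    simp only [smul_add, smul_smul]
    rw [show t ^ 2 * t⁻¹ = t by field_simp, show t ^ 2 * t⁻¹ ^ 2 = 1 by field_simp, one_smul]
    abel
  have htc : (t : ℂ) ≠ 0 := by exact_mod_cast ht0
  let _ : Invertible ((t : ℂ)⁻¹) := invertibleOfNonzero (inv_ne_zero htc)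
  have h2 := Polynomial.eval₂_reflect_mul_pow (RingHom.id ℂ) ((t : ℂ)⁻¹) (2 * m)
    (curvePoly T p q r) (natDegree_curvePoly_le T p q r)
  rw [invOf_eq_inv, inv_inv, ← Complex.ofReal_inv] at h2
  change Polynomial.eval (t : ℂ) _ * _ = Polynomial.eval ((t⁻¹ : ℝ) : ℂ) _ at h2
  change Polynomial.eval (t : ℂ) _ = Polynomial.eval (t : ℂ) _
  rw [eval_curvePoly, h1, contract_smul, ← eval_curvePoly, ← h2, Complex.ofReal_pow,
    Complex.ofReal_inv, inv_pow, ← pow_mul, mul_left_comm, mul_inv_cancel₀ (pow_ne_zero _ htc),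
    mul_one]

/-- A form of degree `m` vanishing to order `m + 1` at both ends of a conic `a² p + a b q + b² r`
vanishes on it. -/
theorem contract_eq_zero_of_isBigO {T : Tensor n m} {p q r : Spacetime n}
    (h0 : (fun t : ℝ => contract T (p + t • q + t ^ 2 • r)) =O[𝓝 0] fun t : ℝ => t ^ (m + 1))
    (h1 : (fun t : ℝ => contract T (r + t • q + t ^ 2 • p)) =O[𝓝 0] fun t : ℝ => t ^ (m + 1)) :
    contract T (p + q + r) = 0 := by
  simp_rw [← eval_curvePoly] at h0 h1
  have hA := Polynomial.X_pow_dvd_iff.mp (X_pow_dvd_of_isBigO (h0.mono nhdsWithin_le_nhds))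
  have hB := Polynomial.X_pow_dvd_iff.mp (X_pow_dvd_of_isBigO (h1.mono nhdsWithin_le_nhds))
  -- The order at t = 0 kills the coefficients with k ≤ m; the order at the other end kills those
  -- with m < k ≤ 2m.
  have hzero : curvePoly T p q r = 0 := by
    ext k
    rw [Polynomial.coeff_zero]
    by_cases hk : k < m + 1
    · exact hA k hk
    by_cases hk2 : k ≤ 2 * m
    · have := hB (2 * m - k) (by omega)
      rwa [curvePoly_reflect, Polynomial.coeff_reflect, Polynomial.revAt_le (by omega),
        Nat.sub_sub_self hk2] at this
    · exact Polynomial.coeff_eq_zero_of_natDegree_lt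
        ((natDegree_curvePoly_le T p q r).trans_lt (by omega))
  have := eval_curvePoly T p q r 1
  rw [hzero, Polynomial.eval_zero] at this
  simpa using this.symm

end Curves

/-! ### Geometry of the light cone -/

section LightCone

variable {n m : ℕ}

/-- The spatial part of a spacetime vector. -/
def spatial : Spacetime n →ₗ[ℝ] EuclideanSpace ℝ (Fin n) where
  toFun x := WithLp.toLp 2 fun j => x j.succ
  map_add' _ _ := rfl
  map_smul' _ _ := rfl

theorem spatial_apply (x : Spacetime n) (j : Fin n) : spatial x j = x j.succ := rfl

theorem continuous_spatial : Continuous (spatial (n := n)) := spatial.continuous_of_finiteDimensional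

theorem direction_zero (c : ℝ) (ω : EuclideanSpace ℝ (Fin n)) : direction c ω 0 = c := rfl

theorem spatial_direction (c : ℝ) (ω : EuclideanSpace ℝ (Fin n)) : spatial (direction c ω) = ω := rfl

theorem ext_spatial {x y : Spacetime n} (h0 : x 0 = y 0) (h : spatial x = spatial y) : x = y := by
  ext k
  refine Fin.cases h0 (fun j => ?_) k
  exact congrArg (fun z : EuclideanSpace ℝ (Fin n) => z j) h

theorem inner_eq_add_inner_spatial (x y : Spacetime n) :
    inner ℝ x y = x 0 * y 0 + inner ℝ (spatial x) (spatial y) := by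
  rw [PiLp.inner_apply, PiLp.inner_apply, Fin.sum_univ_succ]
  simp [spatial_apply, mul_comm]

/-- The Lorentz form `c² ⟨x', y'⟩ - x_0 y_0`. -/
noncomputable def lorentz (c : ℝ) (x y : Spacetime n) : ℝ :=
  c ^ 2 * inner ℝ (spatial x) (spatial y) - x 0 * y 0

theorem lorentz_self_eq_zero_iff (c : ℝ) (x : Spacetime n) :
    lorentz c x x = 0 ↔ x 0 ^ 2 = c ^ 2 * ∑ j : Fin n, x j.succ ^ 2 := by
  have : inner ℝ (spatial x) (spatial x) = ∑ j : Fin n, x j.succ ^ 2 := by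
    rw [PiLp.inner_apply]
    simp [spatial_apply, pow_two]
  rw [lorentz, this]
  constructor <;> intro h <;> linarith [h]

theorem lorentz_direction {c : ℝ} {ω : EuclideanSpace ℝ (Fin n)} (hω : ‖ω‖ = 1) :
    lorentz c (direction c ω) (direction c ω) = 0 := by
  rw [lorentz, spatial_direction, direction_zero, real_inner_self_eq_norm_sq, hω]
  ring

/-- Null vectors that are Lorentz orthogonal are parallel. -/
theorem eq_smul_direction_of_lorentz_eq_zero {c : ℝ} (hc : 0 < c) {ω : EuclideanSpace ℝ (Fin n)}
    (hω : ‖ω‖ = 1) {u : Spacetime n} (hu : lorentz c u u = 0)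
    (h : lorentz c u (direction c ω) = 0) : u = (u 0 / c) • direction c ω := by
  refine ext_spatial ?_ ?_
  · simp [direction_zero, hc.ne']
  · rw [map_smul, spatial_direction, ← sub_eq_zero, ← norm_eq_zero, ← sq_eq_zero_iff,
      norm_sub_sq_real, norm_smul, hω, real_inner_smul_right]
    simp only [lorentz, spatial_direction, direction_zero, real_inner_self_eq_norm_sq] at hu h
    have h1 : inner ℝ (spatial u) ω = u 0 / c := by
      field_simp
      have : c * (c * inner ℝ (spatial u) ω - u 0) = 0 := by linarith
      have := (mul_eq_zero.mp this).resolve_left hc.ne'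
      linarith
    have h2 : ‖spatial u‖ ^ 2 = (u 0 / c) ^ 2 := by
      field_simp
      linarith
    rw [h1, h2, mul_one, Real.norm_eq_abs, sq_abs]
    ring

theorem direction_ne_zero {c : ℝ} (hc : 0 < c) (ω : EuclideanSpace ℝ (Fin n)) :
    direction c ω ≠ 0 := fun h => hc.ne' (by rw [← direction_zero c ω, h]; rfl)

/-- The null vectors with direction in the given cap. -/
def IsCapNull (c : ℝ) (ω₀ : EuclideanSpace ℝ (Fin n)) (δ : ℝ) (x : Spacetime n) : Prop :=
  ∃ a : ℝ, a ≠ 0 ∧ ∃ ω ∈ cap ω₀ δ, x = a • direction c ω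

theorem IsCapNull.ne_zero {c : ℝ} (hc : 0 < c) {ω₀ : EuclideanSpace ℝ (Fin n)} {δ : ℝ}
    {x : Spacetime n} (hx : IsCapNull c ω₀ δ x) : x ≠ 0 := by
  obtain ⟨a, ha, ω, -, rfl⟩ := hx
  exact smul_ne_zero ha (direction_ne_zero hc ω)

theorem isCapNull_direction {c : ℝ} {ω₀ : EuclideanSpace ℝ (Fin n)} {δ : ℝ}
    {ω : EuclideanSpace ℝ (Fin n)} (hω : ω ∈ cap ω₀ δ) : IsCapNull c ω₀ δ (direction c ω) :=
  ⟨1, one_ne_zero, ω, hω, (one_smul ℝ _).symm⟩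

/-- Dividing the spatial part by x_0/c gives a unit vector depending continuously on t near 0, and
the cap is open in the sphere. -/
theorem eventually_isCapNull {c : ℝ} (hc : 0 < c) {ω₀ : EuclideanSpace ℝ (Fin n)} {δ : ℝ}
    {x : ℝ → Spacetime n} (hx : Continuous x) (hnull : ∀ t, lorentz c (x t) (x t) = 0)
    (h0 : IsCapNull c ω₀ δ (x 0)) : ∀ᶠ t in 𝓝 0, IsCapNull c ω₀ δ (x t) := by
  obtain ⟨a, ha, ω, hω, hxa⟩ := h0
  have hx0 : Continuous fun t => x t 0 / c := by fun_prop
  have ha0 : x 0 0 / c = a := by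
    rw [hxa]
    simp [direction_zero, hc.ne']
  have hω' : ContinuousAt (fun t => (x t 0 / c)⁻¹ • spatial (x t)) 0 :=
    (hx0.continuousAt.inv₀ (by rw [ha0]; exact ha)).smul
      (continuous_spatial.comp hx).continuousAt
  have hval : (x 0 0 / c)⁻¹ • spatial (x 0) = ω := by
    rw [ha0, hxa, map_smul, spatial_direction, smul_smul, inv_mul_cancel₀ ha, one_smul]
  have hδ : ∀ᶠ t in 𝓝 0, ‖(x t 0 / c)⁻¹ • spatial (x t) - ω₀‖ < δ := by
    have := (hω'.sub (continuousAt_const (y := ω₀))).norm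
    refine this.eventually_lt_const ?_
    change ‖(x 0 0 / c)⁻¹ • spatial (x 0) - ω₀‖ < δ
    rw [hval]
    exact hω.2
  have hne : ∀ᶠ t in 𝓝 0, x t 0 / c ≠ 0 :=
    hx0.continuousAt.eventually_ne (by rw [ha0]; exact ha)
  filter_upwards [hδ, hne] with t ht hnet
  refine ⟨x t 0 / c, hnet, (x t 0 / c)⁻¹ • spatial (x t), ⟨?_, ht⟩, ?_⟩
  · rw [mem_sphere_zero_iff_norm, ← sq_eq_sq₀ (norm_nonneg _) zero_le_one, norm_smul, mul_pow,
      norm_inv, Real.norm_eq_abs, inv_pow, sq_abs]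
    have h1 := hnull t
    rw [lorentz, real_inner_self_eq_norm_sq] at h1
    have hx : x t 0 ≠ 0 := fun h => hnet (by rw [h, zero_div])
    field_simp
    linarith
  · refine ext_spatial ?_ ?_
    · simp [direction_zero, hc.ne']
    · rw [map_smul, spatial_direction, smul_smul, mul_inv_cancel₀ hnet, one_smul]

/-- There is an open set of covectors which annihilate two distinct directions of the cap. -/
theorem exists_eventually_orthogonal (hn : 3 ≤ n) (c : ℝ) {ω₀ : EuclideanSpace ℝ (Fin n)}
    (hω₀ : ‖ω₀‖ = 1) {δ : ℝ} (hδ : 0 < δ) :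
    ∃ ξ₁ : Spacetime n, ∀ᶠ ξ in 𝓝 ξ₁, ∃ ω₁ ∈ cap ω₀ δ, ∃ ω₂ ∈ cap ω₀ δ, ω₁ ≠ ω₂ ∧
      inner ℝ ξ (direction c ω₁) = 0 ∧ inner ℝ ξ (direction c ω₂) = 0 := by
  have hex : ∀ s : Finset (EuclideanSpace ℝ (Fin n)), s.card < n →
      ∃ e, ‖e‖ = 1 ∧ ∀ x ∈ s, inner ℝ x e = 0 := by
    intro s hs
    have hne : (Submodule.span ℝ (s : Set (EuclideanSpace ℝ (Fin n))))ᗮ ≠ ⊥ := by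
      intro h
      rw [Submodule.orthogonal_eq_bot_iff] at h
      have h1 := finrank_span_finset_le_card (R := ℝ) s
      rw [Set.finrank, h, finrank_top, finrank_euclideanSpace_fin] at h1
      omega
    obtain ⟨y, hy, hy0⟩ := Submodule.exists_mem_ne_zero_of_ne_bot hne
    refine ⟨‖y‖⁻¹ • y, norm_smul_inv_norm hy0, fun x hx => ?_⟩
    rw [real_inner_smul_right, (Submodule.mem_orthogonal _ _).mp hy x (Submodule.subset_span hx),
      mul_zero]
  classical
  -- This is where n ≥ 3 enters: ω₀, η, e are orthonormal. Below, Ω parametrizes their unit sphere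
  -- by longitude θ and latitude φ, with ω₀ at the origin.
  obtain ⟨η, hη, hη0⟩ := hex {ω₀} (by simp; omega)
  obtain ⟨e, he, he0⟩ := hex {ω₀, η} (Finset.card_le_two.trans_lt (by omega))
  have h0η : inner ℝ ω₀ η = 0 := hη0 _ (by simp)
  have h0e : inner ℝ ω₀ e = 0 := he0 _ (by simp)
  have hηe : inner ℝ η e = 0 := he0 _ (by simp)
  have hη0' : inner ℝ η ω₀ = 0 := by rw [real_inner_comm, h0η]
  have he0' : inner ℝ e ω₀ = 0 := by rw [real_inner_comm, h0e]
  have heη' : inner ℝ e η = 0 := by rw [real_inner_comm, hηe]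
  let Ω : ℝ → ℝ → EuclideanSpace ℝ (Fin n) := fun θ φ =>
    Real.cos φ • (Real.cos θ • ω₀ + Real.sin θ • e) + Real.sin φ • η
  have hΩe : ∀ θ φ, inner ℝ e (Ω θ φ) = Real.cos φ * Real.sin θ := by
    intro θ φ
    simp [Ω, inner_add_right, real_inner_smul_right, he0', heη', he]
  have hΩη : ∀ θ φ, inner ℝ η (Ω θ φ) = Real.sin φ := by
    intro θ φ
    simp [Ω, inner_add_right, real_inner_smul_right, hη0', hηe, hη]
  have hΩ0 : ∀ θ φ, inner ℝ ω₀ (Ω θ φ) = Real.cos φ * Real.cos θ := by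
    intro θ φ
    simp [Ω, inner_add_right, real_inner_smul_right, h0η, h0e, hω₀]
  have hΩn : ∀ θ φ, ‖Ω θ φ‖ = 1 := by
    intro θ φ
    rw [← sq_eq_sq₀ (norm_nonneg _) zero_le_one, ← real_inner_self_eq_norm_sq]
    conv_lhs => arg 2; simp only [Ω]
    rw [inner_add_left, real_inner_smul_left, inner_add_left, real_inner_smul_left,
      real_inner_smul_left, real_inner_smul_left, hΩ0, hΩe, hΩη]
    linear_combination Real.cos φ ^ 2 * Real.cos_sq_add_sin_sq θ + Real.sin_sq_add_cos_sq φ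
  have hΩc : Continuous fun z : ℝ × ℝ => ‖Ω z.1 z.2 - ω₀‖ := by
    simp only [Ω]
    fun_prop
  have hnear : ∀ᶠ z : ℝ × ℝ in 𝓝 0, ‖Ω z.1 z.2 - ω₀‖ < δ := by
    refine hΩc.continuousAt.eventually_lt_const ?_
    simpa [Ω] using hδ
  obtain ⟨ε', hε', hball⟩ := Metric.eventually_nhds_iff.mp hnear
  obtain ⟨ε, hε, hεlt⟩ := exists_between (lt_min hε' one_pos)
  have hε1 : ε < 1 := hεlt.trans_le (min_le_right _ _)
  have hcap : ∀ θ φ, |θ| ≤ ε → |φ| ≤ ε → Ω θ φ ∈ cap ω₀ δ := by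
    intro θ φ hθ hφ
    refine ⟨mem_sphere_zero_iff_norm.mpr (hΩn θ φ), hball (y := (θ, φ)) ?_⟩
    rw [dist_zero_right, Prod.norm_def]
    exact (max_le hθ hφ).trans_lt (hεlt.trans_le (min_le_left _ _))
  have hsin : 0 < Real.sin ε := Real.sin_pos_of_pos_of_lt_pi hε (by linarith [Real.pi_gt_three])
  have hinner : ∀ ξ θ φ, inner ℝ ξ (direction c (Ω θ φ)) = ξ 0 * c + inner ℝ (spatial ξ) (Ω θ φ) := by
    intro ξ θ φ
    rw [inner_eq_add_inner_spatial, spatial_direction, direction_zero]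
  -- At ξ = (0, η) the pairing is sin φ. Its opposite signs at φ = ±ε persist for nearby ξ, so there
  -- is a zero in between on each meridian.
  have hroot : ∀ θ, |θ| ≤ ε → ∀ᶠ ξ in 𝓝 (direction 0 η), ∃ φ, |φ| ≤ ε ∧
      inner ℝ ξ (direction c (Ω θ φ)) = 0 := by
    intro θ _
    have hcont : ∀ φ, Continuous fun ξ : Spacetime n => inner ℝ ξ (direction c (Ω θ φ)) := by
      intro φ
      fun_prop
    have hval : ∀ φ, inner ℝ (direction 0 η) (direction c (Ω θ φ)) = Real.sin φ := by
      intro φ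
      rw [hinner, spatial_direction, direction_zero, hΩη, zero_mul, zero_add]
    filter_upwards [(hcont ε).continuousAt.eventually_const_lt (u := 0) (hsin.trans_eq (hval ε).symm),
      (hcont (-ε)).continuousAt.eventually_lt_const (u := 0)
        ((hval (-ε)).trans_lt (by rw [Real.sin_neg]; linarith))] with ξ h1 h2
    have hcφ : Continuous fun φ => inner ℝ ξ (direction c (Ω θ φ)) := by
      simp_rw [hinner]
      simp only [Ω]
      fun_prop
    obtain ⟨φ, hφ, hφ0⟩ := intermediate_value_Icc (by linarith : -ε ≤ ε) hcφ.continuousOn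
      ⟨h2.le, h1.le⟩
    exact ⟨φ, abs_le.mpr hφ, hφ0⟩
  refine ⟨direction 0 η, ?_⟩
  have hcos : ∀ φ, |φ| ≤ ε → 0 < Real.cos φ := fun φ hφ => by
    have := abs_le.mp hφ
    exact Real.cos_pos_of_mem_Ioo ⟨by linarith [Real.pi_gt_three], by linarith [Real.pi_gt_three]⟩
  have hε_abs : |ε| ≤ ε := (abs_of_pos hε).le
  have hnegε_abs : |-ε| ≤ ε := by rw [abs_neg]; exact hε_abs
  -- Zeros on the meridians θ = ±ε are distinct, as their components along e have opposite signs.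
  filter_upwards [hroot ε hε_abs, hroot (-ε) hnegε_abs] with ξ ⟨φ₁, hφ₁, h1⟩ ⟨φ₂, hφ₂, h2⟩
  refine ⟨_, hcap _ _ hε_abs hφ₁, _, hcap _ _ hnegε_abs hφ₂, fun heq => ?_, h1, h2⟩
  have := congrArg (inner ℝ e) heq
  rw [hΩe, hΩe, Real.sin_neg] at this
  have p1 := mul_pos (hcos _ hφ₁) hsin
  have p2 := mul_pos (hcos _ hφ₂) hsin
  linarith

end LightCone

end MLRT

namespace MLRT

open MeasureTheory Filter Topology Asymptotics

/-! ### From the light ray transform to the light cone -/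

section Transform

variable {n m : ℕ} {c : ℝ} {ω₀ : EuclideanSpace ℝ (Fin n)} {δ : ℝ}
  {f : Spacetime n → Tensor n m}

theorem moment_eq_zero_of_isCapNull (hc : 0 < c) (hf : IsTestField f)
    (hL : ∀ ω ∈ cap ω₀ δ, ∀ p, momentumLightRay c m f p ω = 0) {x : Spacetime n}
    (hx : IsCapNull c ω₀ δ x) (p : Spacetime n) :
    ∫ s : ℝ, ((s ^ m : ℝ) : ℂ) * contract (f (p + s • x)) x = 0 := by
  obtain ⟨a, -, ω, hω, rfl⟩ := hx
  have h1 := hL ω hω p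
  rw [momentumLightRay_eq_integral hf m p (direction_ne_zero hc ω)] at h1
  have h2 := Measure.integral_comp_mul_right (fun s : ℝ =>
    ((s ^ m : ℝ) : ℂ) * contract (f (p + s • direction c ω)) (direction c ω)) a
  rw [h1, smul_zero] at h2
  rw [← h2]
  congr 1
  ext s
  rw [contract_smul, smul_smul]
  push_cast
  ring

/-- The final integral is independent of x and ξ; this uniformity permits use along a moving null
vector x(t). -/
theorem norm_contract_fourierTensor_le (hc : 0 < c) (hf : IsTestField f)
    (hL : ∀ ω ∈ cap ω₀ δ, ∀ p, momentumLightRay c m f p ω = 0) {x : Spacetime n}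
    (hx : IsCapNull c ω₀ δ x) {ξ : Spacetime n} (hξ : |inner ℝ ξ x| ≤ ‖x‖) :
    ‖contract (fourierTensor f ξ) x‖ ≤ (|inner ℝ ξ x| / ‖x‖) ^ (m + 1) *
      (‖x‖ ^ m * ∫ y, ‖y‖ ^ (m + 1) * Real.exp ‖y‖ * ∑ i, ‖f y i‖) := by
  rw [contract_fourierTensor hf]
  refine (norm_fourierIntegral_le (hf.continuous_contract x) (hf.hasCompactSupport_contract x)
    (hx.ne_zero hc) (moment_eq_zero_of_isCapNull hc hf hL hx) ξ hξ).trans ?_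
  gcongr
  rw [← integral_const_mul]
  have h1 := hf.continuous_contract x
  have h2 : Continuous fun y => ∑ i, ‖f y i‖ :=
    continuous_finsetSum _ fun i _ => (hf.continuous_apply i).norm
  refine integral_mono ?_ ?_ fun y => ?_
  · exact Continuous.integrable_of_hasCompactSupport (by fun_prop)
      (hf.hasCompactSupport_contract x).norm.mul_left
  · refine Integrable.const_mul (Continuous.integrable_of_hasCompactSupport (by fun_prop) ?_) _
    exact (hf.compactSupport.comp_left (g := fun T : Tensor n m => ∑ i, ‖T i‖) (by simp)).mul_left
  · calc _ ≤ ‖y‖ ^ (m + 1) * Real.exp ‖y‖ * (‖x‖ ^ m * ∑ i, ‖f y i‖) := by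
          gcongr
          exact norm_contract_le _ _
      _ = _ := by ring

theorem contract_fourierTensor_eq_zero_of_orthogonal (hc : 0 < c) (hf : IsTestField f)
    (hL : ∀ ω ∈ cap ω₀ δ, ∀ p, momentumLightRay c m f p ω = 0) {x : Spacetime n}
    (hx : IsCapNull c ω₀ δ x) {ξ : Spacetime n} (hξ : inner ℝ ξ x = 0) :
    contract (fourierTensor f ξ) x = 0 := by
  have := norm_contract_fourierTensor_le hc hf hL hx (ξ := ξ) (by simp [hξ])
  simpa [hξ] using this

/-- Since ξ annihilates p and r, its pairing with the curve is exactly t⟨ξ, q⟩, and the power m + 1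
supplies t^{m+1}. The other factors stay bounded because the curve starts at p ≠ 0. -/
theorem contract_fourierTensor_isBigO (hc : 0 < c) (hf : IsTestField f)
    (hL : ∀ ω ∈ cap ω₀ δ, ∀ p, momentumLightRay c m f p ω = 0) {ξ p q r : Spacetime n}
    (hp : IsCapNull c ω₀ δ p) (hξp : inner ℝ ξ p = 0) (hξr : inner ℝ ξ r = 0)
    (hnull : ∀ t : ℝ, lorentz c (p + t • q + t ^ 2 • r) (p + t • q + t ^ 2 • r) = 0) :
    (fun t : ℝ => contract (fourierTensor f ξ) (p + t • q + t ^ 2 • r)) =O[𝓝 0]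
      fun t : ℝ => t ^ (m + 1) := by
  set x : ℝ → Spacetime n := fun t => p + t • q + t ^ 2 • r with hx
  have hxc : Continuous x := by fun_prop
  have hx0 : x 0 = p := by simp [hx]
  have hp0 : 0 < ‖p‖ := norm_pos_iff.mpr (hp.ne_zero hc)
  have hinner : ∀ t, inner ℝ ξ (x t) = t * inner ℝ ξ q := by
    intro t
    simp [hx, inner_add_right, real_inner_smul_right, hξp, hξr]
  set K := ∫ y, ‖y‖ ^ (m + 1) * Real.exp ‖y‖ * ∑ i, ‖f y i‖ with hK
  let g : ℝ → ℝ := fun t => (|inner ℝ ξ q| / ‖x t‖) ^ (m + 1) * (‖x t‖ ^ m * K)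
  have hg : ContinuousAt g 0 := by
    have hn : ContinuousAt (fun t => ‖x t‖) 0 := hxc.norm.continuousAt
    exact ((continuousAt_const.div hn (by rw [hx0]; exact hp0.ne')).pow _).mul
      ((hn.pow _).mul continuousAt_const)
  have h1 : ∀ᶠ t in 𝓝 0, IsCapNull c ω₀ δ (x t) :=
    eventually_isCapNull hc hxc hnull (by rwa [hx0])
  have h2 : ∀ᶠ t in 𝓝 0, |inner ℝ ξ (x t)| - ‖x t‖ < 0 := by
    have : Continuous fun t => |inner ℝ ξ (x t)| - ‖x t‖ := by fun_prop
    refine this.continuousAt.eventually_lt_const ?_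
    change |inner ℝ ξ (x 0)| - ‖x 0‖ < 0
    rw [hx0, hξp, abs_zero]
    linarith
  have h3 : (fun t => contract (fourierTensor f ξ) (x t)) =O[𝓝 0] fun t => t ^ (m + 1) * g t := by
    refine IsBigO.of_bound 1 ?_
    filter_upwards [h1, h2] with t ht1 ht2
    refine (norm_contract_fourierTensor_le hc hf hL ht1 (by linarith)).trans ?_
    rw [one_mul, hinner, abs_mul, mul_div_assoc, mul_pow, norm_mul, norm_pow, Real.norm_eq_abs,
      mul_assoc]
    gcongr
    exact Real.le_norm_self _
  have h4 : g =O[𝓝 0] fun _ => (1 : ℝ) := hg.tendsto.isBigO_one ℝ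
  simpa using h3.trans ((isBigO_refl _ _).mul h4)

theorem contract_fourierTensor_eq_zero_of_null (hc : 0 < c) (hf : IsTestField f)
    (hL : ∀ ω ∈ cap ω₀ δ, ∀ p, momentumLightRay c m f p ω = 0)
    {ω₁ ω₂ : EuclideanSpace ℝ (Fin n)} (h₁ : ω₁ ∈ cap ω₀ δ) (h₂ : ω₂ ∈ cap ω₀ δ) (hne : ω₁ ≠ ω₂)
    {ξ : Spacetime n} (hξ₁ : inner ℝ ξ (direction c ω₁) = 0)
    (hξ₂ : inner ℝ ξ (direction c ω₂) = 0) {u : Spacetime n} (hu : lorentz c u u = 0) :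
    contract (fourierTensor f ξ) u = 0 := by
  have hn₁ : ‖ω₁‖ = 1 := mem_sphere_zero_iff_norm.mp h₁.1
  have hn₂ : ‖ω₂‖ = 1 := mem_sphere_zero_iff_norm.mp h₂.1
  -- The degenerate case: u is a multiple of a cap direction annihilated by ξ, so no conic is
  -- needed.
  have hparallel : ∀ ω ∈ cap ω₀ δ, inner ℝ ξ (direction c ω) = 0 →
      lorentz c u (direction c ω) = 0 → contract (fourierTensor f ξ) u = 0 := by
    intro ω hω hξω hl
    rw [eq_smul_direction_of_lorentz_eq_zero hc (mem_sphere_zero_iff_norm.mp hω.1) hu hl,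
      contract_smul, contract_fourierTensor_eq_zero_of_orthogonal hc hf hL
        (isCapNull_direction hω) hξω, mul_zero]
  by_cases hl₁ : lorentz c u (direction c ω₁) = 0
  · exact hparallel ω₁ h₁ hξ₁ hl₁
  by_cases hl₂ : lorentz c u (direction c ω₂) = 0
  · exact hparallel ω₂ h₂ hξ₂ hl₂
  set d := lorentz c (direction c ω₁) (direction c ω₂) with hd
  -- Here d = c²(⟨ω₁, ω₂⟩ - 1), nonzero by the equality case of Cauchy–Schwarz.
  have hd0 : d ≠ 0 := by
    intro h0
    rw [hd, lorentz, spatial_direction, spatial_direction, direction_zero, direction_zero] at h0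
    have h : c ^ 2 * (inner ℝ ω₁ ω₂ - 1) = 0 := by linear_combination h0
    have h' := (mul_eq_zero.mp h).resolve_left (pow_ne_zero 2 hc.ne')
    exact hne ((inner_eq_one_iff_of_norm_eq_one (𝕜 := ℝ) hn₁ hn₂).mp (by linarith))
  -- With these α, β the vector q = u - αv₁ - βv₂ is Lorentz orthogonal to v₁ and v₂ and has Lorentz
  -- square -2αβd, which makes the whole conic null.
  set α := lorentz c u (direction c ω₂) / d with hα
  set β := lorentz c u (direction c ω₁) / d with hβ
  have hαd : lorentz c u (direction c ω₂) = α * d := by rw [hα, div_mul_cancel₀ _ hd0]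
  have hβd : lorentz c u (direction c ω₁) = β * d := by rw [hβ, div_mul_cancel₀ _ hd0]
  have hα0 : α ≠ 0 := div_ne_zero hl₂ hd0
  have hβ0 : β ≠ 0 := div_ne_zero hl₁ hd0
  set v₁ := direction c ω₁
  set v₂ := direction c ω₂
  have hv₁ : lorentz c v₁ v₁ = 0 := lorentz_direction hn₁
  have hv₂ : lorentz c v₂ v₂ = 0 := lorentz_direction hn₂
  have hnull : ∀ a b : ℝ, lorentz c
      ((a ^ 2 * α) • v₁ + (a * b) • (u - α • v₁ - β • v₂) + (b ^ 2 * β) • v₂)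
      ((a ^ 2 * α) • v₁ + (a * b) • (u - α • v₁ - β • v₂) + (b ^ 2 * β) • v₂) = 0 := by
    intro a b
    have e₁ : inner ℝ (spatial v₁) (spatial u) = inner ℝ (spatial u) (spatial v₁) :=
      real_inner_comm _ _
    have e₂ : inner ℝ (spatial v₂) (spatial u) = inner ℝ (spatial u) (spatial v₂) :=
      real_inner_comm _ _
    have e₃ : inner ℝ (spatial v₂) (spatial v₁) = inner ℝ (spatial v₁) (spatial v₂) :=
      real_inner_comm _ _
    simp only [lorentz] at hu hαd hβd hv₁ hv₂ hd
    simp only [lorentz, map_add, map_sub, map_smul, inner_add_left, inner_add_right,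
      inner_sub_left, inner_sub_right, real_inner_smul_left, real_inner_smul_right, PiLp.add_apply,
      PiLp.sub_apply, PiLp.smul_apply, smul_eq_mul, e₁, e₂, e₃]
    -- The coefficients come from rewriting the point as (a² - ab)α v₁ + ab u + (b² - ab)β v₂.
    linear_combination ((a ^ 2 - a * b) * α) ^ 2 * hv₁ + (a * b) ^ 2 * hu +
      ((b ^ 2 - a * b) * β) ^ 2 * hv₂ + 2 * ((a ^ 2 - a * b) * α) * (a * b) * hβd +
      2 * (a * b) * ((b ^ 2 - a * b) * β) * hαd -
      2 * ((a ^ 2 - a * b) * α) * ((b ^ 2 - a * b) * β) * hd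
  have hξq : ∀ a : ℝ, inner ℝ ξ (a • v₁) = 0 := fun a => by
    rw [real_inner_smul_right, hξ₁, mul_zero]
  have hξr : ∀ a : ℝ, inner ℝ ξ (a • v₂) = 0 := fun a => by
    rw [real_inner_smul_right, hξ₂, mul_zero]
  have key := contract_eq_zero_of_isBigO
    (contract_fourierTensor_isBigO hc hf hL (p := α • v₁) (q := u - α • v₁ - β • v₂) (r := β • v₂)
      ⟨α, hα0, ω₁, h₁, rfl⟩ (hξq α) (hξr β) fun t => by
        have := hnull 1 t
        simpa only [one_pow, one_mul, smul_smul] using this)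
    (contract_fourierTensor_isBigO hc hf hL (p := β • v₂) (q := u - α • v₁ - β • v₂) (r := α • v₁)
      ⟨β, hβ0, ω₂, h₂, rfl⟩ (hξr β) (hξq α) fun t => by
        have := hnull t 1
        rw [add_right_comm, add_comm ((t ^ 2 * α) • v₁), add_right_comm] at this
        simpa only [one_pow, one_mul, mul_one, smul_smul] using this)
  have hsum : α • v₁ + (u - α • v₁ - β • v₂) + β • v₂ = u := by abel
  rwa [hsum] at key

/-- A field whose momentum light ray transform of order `m` vanishes over a cap of directions
vanishes pointwise on the whole light cone. -/
theorem contract_eq_zero_of_momentumLightRay_eq_zero (hn : 3 ≤ n) (hc : 0 < c) (hω₀ : ‖ω₀‖ = 1)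
    (hδ : 0 < δ) (hf : IsTestField f)
    (hL : ∀ ω ∈ cap ω₀ δ, ∀ p, momentumLightRay c m f p ω = 0) (y x : Spacetime n)
    (hx : x 0 ^ 2 = c ^ 2 * ∑ j : Fin n, x j.succ ^ 2) : contract (f y) x = 0 := by
  obtain ⟨ξ₁, hξ₁⟩ := exists_eventually_orthogonal hn c hω₀ hδ
  refine congrFun (eq_zero_of_fourierIntegral_eventually_zero (hf.continuous_contract x)
    (hf.hasCompactSupport_contract x) (ξ₁ := ξ₁) ?_) y
  filter_upwards [hξ₁] with ξ ⟨ω₁, h₁, ω₂, h₂, hne, hi₁, hi₂⟩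
  rw [← contract_fourierTensor hf]
  exact contract_fourierTensor_eq_zero_of_null hc hf hL h₁ h₂ hne hi₁ hi₂
    ((lorentz_self_eq_zero_iff c x).mpr hx)

/-- Choosing u separately at each p would lose smoothness. A single linear right inverse of
multiplication by v, extended to all tensors, preserves smoothness and compact support. -/
theorem exists_testField_symMul_eq (hm : 2 ≤ m) (v : Tensor n 2) (hf : IsTestField f)
    (h : ∀ p, ∃ u ∈ symTensor n (m - 2), symMul hm v u = f p) :
    ∃ h : Spacetime n → Tensor n (m - 2), IsTestField h ∧ ∀ p, f p = symMul hm v (h p) := by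
  obtain ⟨S₀, hS₀⟩ := (symMulLin hm v).rangeRestrict.exists_rightInverse_of_surjective
    (LinearMap.range_rangeRestrict _)
  obtain ⟨S, hS⟩ := S₀.exists_extend
  let R : Tensor n m →ₗ[ℝ] Tensor n (m - 2) :=
    ((symTensor n (m - 2)).subtype ∘ₗ S).restrictScalars ℝ
  refine ⟨fun p => R (f p), ⟨fun p => (S (f p)).2, ?_, ?_⟩, fun p => ?_⟩
  · exact R.toContinuousLinearMap.contDiff.comp hf.smooth
  · exact hf.compactSupport.comp_left (map_zero R)
  · obtain ⟨u, hu, hup⟩ := h p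
    have hmem : f p ∈ LinearMap.range (symMulLin hm v) := ⟨⟨u, hu⟩, hup⟩
    have h1 : S (f p) = S₀ ⟨f p, hmem⟩ := LinearMap.congr_fun hS ⟨f p, hmem⟩
    have h2 := congrArg Subtype.val (LinearMap.congr_fun hS₀ ⟨f p, hmem⟩)
    change f p = symMulLin hm v (S (f p))
    rw [h1]
    exact h2.symm

theorem momentumLightRay_symMul_eq_zero (hc : 0 < c) (hm : 2 ≤ m) (hf : IsTestField f)
    {h : Spacetime n → Tensor n (m - 2)}
    (hfh : ∀ p, f p = symMul hm (minkowski n (1 / c)) (h p)) {ω : EuclideanSpace ℝ (Fin n)}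
    (hω : ‖ω‖ = 1) (k : ℕ) (p : Spacetime n) : momentumLightRay c k f p ω = 0 := by
  rw [momentumLightRay_eq_integral hf k p (direction_ne_zero hc ω)]
  have h0 : contract (minkowski n (1 / c)) (direction c ω) = 0 := by
    have h1 := (lorentz_self_eq_zero_iff c (direction c ω)).mp (lorentz_direction hω)
    have h2 : ∑ j : Fin n, direction c ω j.succ ^ 2 = 1 := by
      rw [direction_zero] at h1
      exact (mul_left_cancel₀ (pow_ne_zero 2 hc.ne') (by rw [mul_one]; exact h1)).symm
    rw [contract_minkowski, h2, direction_zero, one_div, inv_mul_cancel₀ hc.ne']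
    norm_num
  simp_rw [hfh, contract_symMul, h0, zero_mul, mul_zero, integral_zero]

end Transform

end MLRT

theorem theorem3 (n m : ℕ) (hn : 3 ≤ n) (c : ℝ) (hc : 0 < c)
    (ω₀ : EuclideanSpace ℝ (Fin n)) (hω₀ : ω₀ ∈ Metric.sphere (0 : EuclideanSpace ℝ (Fin n)) 1)
    (δ : ℝ) (hδ : 0 < δ)
    (f : MLRT.Spacetime n → MLRT.Tensor n m) (hf : MLRT.IsTestField f) :
    (m ≤ 1 →
      ((∀ ω ∈ MLRT.cap ω₀ δ, ∀ p, MLRT.momentumLightRay c m f p ω = 0) ↔ f = 0)) ∧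
    (∀ hm : 2 ≤ m,
      ((∀ ω ∈ MLRT.cap ω₀ δ, ∀ p, MLRT.momentumLightRay c m f p ω = 0) ↔
        ∃ h : MLRT.Spacetime n → MLRT.Tensor n (m - 2), MLRT.IsTestField h ∧
          ∀ p, f p = MLRT.symMul hm (MLRT.minkowski n (1 / c)) (h p))) := by
  have hω₀' : ‖ω₀‖ = 1 := mem_sphere_zero_iff_norm.mp hω₀
  have hn0 : 0 < n := by omega
  refine ⟨fun hm => ⟨fun hL => ?_, ?_⟩, fun hm => ⟨fun hL => ?_, ?_⟩⟩
  · funext p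
    exact MLRT.eq_zero_of_vanishes_on_cone hn0 hc hm (hf.symm p) fun x hx =>
      MLRT.contract_eq_zero_of_momentumLightRay_eq_zero hn hc hω₀' hδ hf hL p x hx
  · rintro rfl ω - p
    simp [MLRT.momentumLightRay]
  · exact MLRT.exists_testField_symMul_eq hm _ hf fun p =>
      MLRT.exists_symMul_of_vanishes_on_cone hn0 hc hm (hf.symm p) fun x hx =>
        MLRT.contract_eq_zero_of_momentumLightRay_eq_zero hn hc hω₀' hδ hf hL p x hx
  · rintro ⟨h, -, hfh⟩ ω hω p
    exact MLRT.momentumLightRay_symMul_eq_zero hc hm hf hfh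
      (mem_sphere_zero_iff_norm.mp hω.1) m p
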